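/- Let $k$ be a field, let $A$ be a finite-dimensional associative unital $k$-algebra, and let $DA=\operatorname{Hom}_k(A,k)$ be the dual coalgebra; its comultiplication is the dual $DA\to D(A\otimes A)\cong DA\otimes DA$ of the multiplication of $A$, its counit is evaluation at $1$, and $\otimes=\otimes_k$. A left $A$-module $M$ is regarded as a right $DA$-comodule through $\Delta_M\colon M\to \operatorname{Hom}_k(A,M)\cong M\otimes DA$, $\Delta_M(m)(a)=am$, and a right $A$-module $N$ as a left $DA$-comodule through $\Delta_N\colon N\to\operatorname{Hom}_k(A,N)\cong DA\otimes N$, $\Delta_N(n)(a)=na$. For a right comodule $X$ and a left comodule $Y$, the cotensor product $X\,\square\,Y$ is the kernel of the map $$X\otimes Y\to X\otimes DA\otimes Y,\qquad x\otimes y\mapsto \Delta_X(x)\otimes y-x\otimes\Delta_Y(y).$$ The space $\mathrm{Cotor}^n_{DA}(X,Y)$ is the $n$-th cohomology of the total complex of $I^*\,\square\,J^*$, where $X\to I^*$ and $Y\to J^*$ are injective resolutions in the categories of right and of left $DA$-comodules. Let $A^e=A\otimes A^{\mathrm{op}}$, and let $M\otimes N$ be the $A$-bimodule with $a(m\otimes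 n)b=am\otimes nb$. For an $A$-bimodule $B$, the Hochschild cohomology is $H^n(A,B)=\operatorname{Ext}^n_{A^e}(A,B)$. **Theorem.** Every right and every left $DA$-comodule has an injective resolution, and every comodule map lifts to a cochain map between any given injective resolutions of its source and target. For every $n\ge 0$, all left $A$-modules $M$ and right $A$-modules $N$, and all injective comodule resolutions used to compute $\mathrm{Cotor}$, there is a $k$-linear isomorphism $$\mathrm{Cotor}^n_{DA}(M,N)\;\cong\;H^n(A,M\otimes N)=\operatorname{Ext}^n_{A^e}(A,M\otimes N).$$ These isomorphisms can be chosen to be natural: for all module maps $f\colon M\to M'$ and $g\colon N\to N'$ and all cochain maps between the chosen resolutions that lift $f$ and $g$, they commute with the induced maps on $\mathrm{Cotor}^n_{DA}$ and with the map $H^n(A,M\otimes N)\to H^n(A,M'\otimes N')$ induced by $f\otimes g$. -/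

import Mathlib

open CategoryTheory Limits TensorProduct

universe u

noncomputable section

/-! ### Comodules over a coalgebra -/

/-- Right comodules over a `k`-coalgebra `C`: a `k`-module `M` with a coassociative and counital
structure map `M → M ⊗ C`. -/
structure RComod (k C : Type u) [Field k] [AddCommGroup C] [Module k C] [Coalgebra k C] where
  carrier : Type u
  [addCommGroup : AddCommGroup carrier]
  [module : Module k carrier]
  coact : carrier →ₗ[k] carrier ⊗[k] C
  coassoc : (TensorProduct.assoc k carrier C C).toLinearMap ∘ₗ coact.rTensor C ∘ₗ coact =
    (Coalgebra.comul (R := k) (A := C)).lTensor carrier ∘ₗ coact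
  counit : (TensorProduct.rid k carrier).toLinearMap ∘ₗ
    (Coalgebra.counit (R := k) (A := C)).lTensor carrier ∘ₗ coact = LinearMap.id

/-- Left comodules over a `k`-coalgebra `C`: a `k`-module `N` with a coassociative and counital
structure map `N → C ⊗ N`. -/
structure LComod (k C : Type u) [Field k] [AddCommGroup C] [Module k C] [Coalgebra k C] where
  carrier : Type u
  [addCommGroup : AddCommGroup carrier]
  [module : Module k carrier]
  coact : carrier →ₗ[k] C ⊗[k] carrier
  coassoc : (TensorProduct.assoc k C C carrier).toLinearMap ∘ₗ
      (Coalgebra.comul (R := k) (A := C)).rTensor carrier ∘ₗ coact =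
    coact.lTensor C ∘ₗ coact
  counit : (TensorProduct.lid k carrier).toLinearMap ∘ₗ
    (Coalgebra.counit (R := k) (A := C)).rTensor carrier ∘ₗ coact = LinearMap.id

attribute [instance] RComod.addCommGroup RComod.module LComod.addCommGroup LComod.module

section Categories

variable {k C : Type u} [Field k] [AddCommGroup C] [Module k C] [Coalgebra k C]

namespace RComod

/-- Comodule maps: the `k`-linear maps that commute with the structure maps. -/
def homs (M N : RComod k C) : Submodule k (M.carrier →ₗ[k] N.carrier) where
  carrier := {f | N.coact ∘ₗ f = f.rTensor C ∘ₗ M.coact}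
  add_mem' {f g} hf hg := by
    simp only [Set.mem_ofPred_eq] at *
    rw [LinearMap.comp_add, hf, hg, LinearMap.rTensor_add, LinearMap.add_comp]
  zero_mem' := by simp
  smul_mem' c f hf := by
    simp only [Set.mem_ofPred_eq] at *
    rw [LinearMap.comp_smul, hf, LinearMap.rTensor_smul, LinearMap.smul_comp]

instance : Category (RComod k C) where
  Hom M N := homs M N
  id M := ⟨LinearMap.id, by simp [homs]⟩
  comp {X Y Z} f g := ⟨g.1 ∘ₗ f.1, by
    have hf : Y.coact ∘ₗ f.1 = f.1.rTensor C ∘ₗ X.coact := f.2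
    have hg : Z.coact ∘ₗ g.1 = g.1.rTensor C ∘ₗ Y.coact := g.2
    change Z.coact ∘ₗ g.1 ∘ₗ f.1 = (g.1 ∘ₗ f.1).rTensor C ∘ₗ X.coact
    rw [← LinearMap.comp_assoc, hg, LinearMap.comp_assoc, hf, LinearMap.rTensor_comp,
      LinearMap.comp_assoc]⟩

/-- The underlying linear map of a comodule map. -/
def Hom.lin {M N : RComod k C} (f : M ⟶ N) : M.carrier →ₗ[k] N.carrier := f.1

instance : Preadditive (RComod k C) where
  homGroup M N := inferInstanceAs (AddCommGroup (homs M N))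
  add_comp _ _ _ f f' g := Subtype.ext (LinearMap.comp_add f.1 f'.1 g.1)
  comp_add _ _ _ f g g' := Subtype.ext (LinearMap.add_comp f.1 g'.1 g.1)

instance : HasZeroObject (RComod k C) where
  zero := ⟨{ carrier := PUnit, coact := 0, coassoc := by simp, counit := by ext },
    (IsZero.iff_id_eq_zero _).2 (Subtype.ext (LinearMap.ext fun _ => rfl))⟩

end RComod

namespace LComod

/-- Comodule maps: the `k`-linear maps that commute with the structure maps. -/
def homs (M N : LComod k C) : Submodule k (M.carrier →ₗ[k] N.carrier) where
  carrier := {f | N.coact ∘ₗ f = f.lTensor C ∘ₗ M.coact}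
  add_mem' {f g} hf hg := by
    simp only [Set.mem_ofPred_eq] at *
    rw [LinearMap.comp_add, hf, hg, LinearMap.lTensor_add, LinearMap.add_comp]
  zero_mem' := by simp
  smul_mem' c f hf := by
    simp only [Set.mem_ofPred_eq] at *
    rw [LinearMap.comp_smul, hf, LinearMap.lTensor_smul, LinearMap.smul_comp]

instance : Category (LComod k C) where
  Hom M N := homs M N
  id M := ⟨LinearMap.id, by simp [homs]⟩
  comp {X Y Z} f g := ⟨g.1 ∘ₗ f.1, by
    have hf : Y.coact ∘ₗ f.1 = f.1.lTensor C ∘ₗ X.coact := f.2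
    have hg : Z.coact ∘ₗ g.1 = g.1.lTensor C ∘ₗ Y.coact := g.2
    change Z.coact ∘ₗ g.1 ∘ₗ f.1 = (g.1 ∘ₗ f.1).lTensor C ∘ₗ X.coact
    rw [← LinearMap.comp_assoc, hg, LinearMap.comp_assoc, hf, LinearMap.lTensor_comp,
      LinearMap.comp_assoc]⟩

/-- The underlying linear map of a comodule map. -/
def Hom.lin {M N : LComod k C} (f : M ⟶ N) : M.carrier →ₗ[k] N.carrier := f.1

instance : Preadditive (LComod k C) where
  homGroup M N := inferInstanceAs (AddCommGroup (homs M N))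
  add_comp _ _ _ f f' g := Subtype.ext (LinearMap.comp_add f.1 f'.1 g.1)
  comp_add _ _ _ f g g' := Subtype.ext (LinearMap.add_comp f.1 g'.1 g.1)

instance : HasZeroObject (LComod k C) where
  zero := ⟨{ carrier := PUnit, coact := 0, coassoc := by simp, counit := by ext },
    (IsZero.iff_id_eq_zero _).2 (Subtype.ext (LinearMap.ext fun _ => rfl))⟩

end LComod

/-! ### The cotensor product and Cotor -/

/-- The map `M ⊗ N → M ⊗ C ⊗ N`, `m ⊗ n ↦ Δ m ⊗ n - m ⊗ Δ n`. -/
def cotensorMap (M : RComod k C) (N : LComod k C) :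
    M.carrier ⊗[k] N.carrier →ₗ[k] M.carrier ⊗[k] (C ⊗[k] N.carrier) :=
  (TensorProduct.assoc k M.carrier C N.carrier).toLinearMap ∘ₗ M.coact.rTensor N.carrier -
    N.coact.lTensor M.carrier

theorem cotensorMap_naturality {M M' : RComod k C} {N N' : LComod k C} (f : M ⟶ M') (g : N ⟶ N') :
    cotensorMap M' N' ∘ₗ TensorProduct.map (RComod.Hom.lin f) (LComod.Hom.lin g) =
      TensorProduct.map (RComod.Hom.lin f) ((LComod.Hom.lin g).lTensor C) ∘ₗ cotensorMap M N := by
  have hf : ∀ m, M'.coact (RComod.Hom.lin f m) = (RComod.Hom.lin f).rTensor C (M.coact m) :=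
    LinearMap.congr_fun f.2
  have hg : ∀ n, N'.coact (LComod.Hom.lin g n) = (LComod.Hom.lin g).lTensor C (N.coact n) :=
    LinearMap.congr_fun g.2
  refine TensorProduct.ext' fun m n => ?_
  simp only [cotensorMap, LinearMap.comp_apply, LinearMap.sub_apply, TensorProduct.map_tmul,
    LinearMap.rTensor_tmul, LinearMap.lTensor_tmul, map_sub, hf, hg, LinearEquiv.coe_coe]
  congr 1
  induction M.coact m using TensorProduct.induction_on with
  | zero => simp
  | tmul x y => simp
  | add x y hx hy => simp only [map_add, TensorProduct.add_tmul, hx, hy]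

/-- The map `M □ N → M' □ N'` induced by comodule maps `M → M'` and `N → N'`. -/
def cotensorHom {M M' : RComod k C} {N N' : LComod k C} (f : M ⟶ M') (g : N ⟶ N') :
    LinearMap.ker (cotensorMap M N) →ₗ[k] LinearMap.ker (cotensorMap M' N') :=
  (TensorProduct.map (RComod.Hom.lin f) (LComod.Hom.lin g)).restrict fun x hx => by
    have h := LinearMap.congr_fun (cotensorMap_naturality f g) x
    simp only [LinearMap.comp_apply, LinearMap.mem_ker.1 hx, map_zero] at h
    exact LinearMap.mem_ker.2 h

variable (k C) in
/-- The cotensor product `M □ N`, the kernel of `cotensorMap M N`, as a bifunctor. -/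
def cotensor : RComod k C ⥤ LComod k C ⥤ ModuleCat.{u} k where
  obj M :=
    { obj := fun N => ModuleCat.of k (LinearMap.ker (cotensorMap M N))
      map := fun g => ModuleCat.ofHom (cotensorHom (𝟙 M) g)
      map_id := fun N => by
        ext x
        exact LinearMap.congr_fun TensorProduct.map_id x.1
      map_comp := fun g g' => by
        ext x
        exact LinearMap.congr_fun
          (TensorProduct.map_comp LinearMap.id (LComod.Hom.lin g')
            LinearMap.id (LComod.Hom.lin g)) x.1 }
  map {M M'} f :=
    { app := fun N => ModuleCat.ofHom (cotensorHom f (𝟙 N))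
      naturality := fun N N' g => by
        ext x
        have h₁ := LinearMap.congr_fun (TensorProduct.map_comp (RComod.Hom.lin f) LinearMap.id
            LinearMap.id (LComod.Hom.lin g)) x.1
        have h₂ := LinearMap.congr_fun (TensorProduct.map_comp LinearMap.id (LComod.Hom.lin g)
            (RComod.Hom.lin f) LinearMap.id) x.1
        exact h₁.symm.trans h₂ }
  map_id M := by
    ext N x
    exact LinearMap.congr_fun TensorProduct.map_id x.1
  map_comp f f' := by
    ext N x
    exact LinearMap.congr_fun
      (TensorProduct.map_comp (RComod.Hom.lin f') LinearMap.id
        (RComod.Hom.lin f) LinearMap.id) x.1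

instance : (cotensor k C).PreservesZeroMorphisms where
  map_zero M M' := by
    have h (N : LComod k C) : cotensorHom (0 : M ⟶ M') (𝟙 N) = 0 :=
      LinearMap.ext fun x => Subtype.ext (LinearMap.congr_fun
        (TensorProduct.map_zero_left (LinearMap.id (R := k) (M := N.carrier))) x.1)
    ext N : 2
    exact congrArg ModuleCat.ofHom (h N)

instance (M : RComod k C) : ((cotensor k C).obj M).PreservesZeroMorphisms where
  map_zero N N' := by
    have h : cotensorHom (𝟙 M) (0 : N ⟶ N') = 0 :=
      LinearMap.ext fun x => Subtype.ext (LinearMap.congr_fun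
        (TensorProduct.map_zero_right (LinearMap.id (R := k) (M := M.carrier))) x.1)
    exact congrArg ModuleCat.ofHom h

/-- The signs `(-1)^p` in the total complexes of double cochain complexes indexed by `ℕ`. -/
instance : (ComplexShape.up ℕ).TensorSigns where
  ε' := MonoidHom.mk' (fun (i : ℕ) => (-1 : ℤˣ) ^ i) (pow_add (-1 : ℤˣ))
  rel_add p q r (hpq : p + 1 = q) := by simp only [ComplexShape.up_Rel]; lia
  add_rel p q r (hpq : p + 1 = q) := by simp only [ComplexShape.up_Rel]; lia
  ε'_succ := by
    rintro p _ rfl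
    exact (pow_succ (-1 : ℤˣ) p).trans (mul_neg_one _)

/-- The total complex of the double complex `I □ J`. -/
abbrev cotensorComplex (I : CochainComplex (RComod k C) ℕ) (J : CochainComplex (LComod k C) ℕ) :
    CochainComplex (ModuleCat.{u} k) ℕ :=
  HomologicalComplex.mapBifunctor I J (cotensor k C) (ComplexShape.up ℕ)

/-- `Cotor^n_C(M, N)`: the `n`-th cohomology of the total complex of `I □ J`, for injective
resolutions `I` of the right comodule `M` and `J` of the left comodule `N`. -/
def cotor {M : RComod k C} {N : LComod k C} (I : InjectiveResolution M) (J : InjectiveResolution N)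
    (n : ℕ) : ModuleCat.{u} k :=
  (cotensorComplex I.cocomplex J.cocomplex).homology n

/-- The map induced on Cotor by cochain maps between the injective resolutions. -/
def cotorMap {M M' : RComod k C} {N N' : LComod k C}
    {I : InjectiveResolution M} {I' : InjectiveResolution M'}
    {J : InjectiveResolution N} {J' : InjectiveResolution N'}
    (φ : I.cocomplex ⟶ I'.cocomplex) (ψ : J.cocomplex ⟶ J'.cocomplex) (n : ℕ) :
    cotor I J n ⟶ cotor I' J' n :=
  HomologicalComplex.homologyMap
    (HomologicalComplex.mapBifunctorMap φ ψ (cotensor k C) (ComplexShape.up ℕ)) n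

end Categories

/-- The cochain map `φ` between resolutions lifts `f`, i.e. it is compatible with `f` and the
augmentations. -/
def IsLiftOf {𝒞 : Type*} [Category* 𝒞] [HasZeroObject 𝒞] [HasZeroMorphisms 𝒞] {X Y : 𝒞}
    {I : InjectiveResolution X} {J : InjectiveResolution Y} (φ : I.cocomplex ⟶ J.cocomplex)
    (f : X ⟶ Y) : Prop :=
  I.ι ≫ φ = (CochainComplex.single₀ 𝒞).map f ≫ J.ι

/-! ### The dual coalgebra and the comodules associated with modules -/

section Dual

set_option linter.unusedSectionVars false

variable (k A : Type u) [Field k] [Ring A] [Algebra k A] [Module.Finite k A]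

open Module

/-- The identification of `DA ⊗ (DA ⊗ DA)` with the dual of `A ⊗ (A ⊗ A)`. -/
def dualTriple : Dual k A ⊗[k] (Dual k A ⊗[k] Dual k A) ≃ₗ[k] Dual k (A ⊗[k] (A ⊗[k] A)) :=
  TensorProduct.congr (LinearEquiv.refl k _) (dualDistribEquiv k A A) ≪≫ₗ
    dualDistribEquiv k A (A ⊗[k] A)

/-- The comultiplication of `DA`: the dual `DA → D(A ⊗ A) ≅ DA ⊗ DA` of the multiplication. -/
def dualComul : Dual k A →ₗ[k] Dual k A ⊗[k] Dual k A :=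
  (dualDistribEquiv k A A).symm.toLinearMap ∘ₗ (LinearMap.mul' k A).dualMap

/-- The counit of `DA`: the dual of the unit of `A`, i.e. evaluation at `1`. -/
def dualCounit : Dual k A →ₗ[k] k := Dual.eval k A 1

variable {k A}

theorem dualDistrib_dualComul (f : Dual k A) (a b : A) :
    dualDistrib k A A (dualComul k A f) (a ⊗ₜ b) = f (a * b) :=
  LinearMap.congr_fun ((dualDistribEquiv k A A).apply_symm_apply
    ((LinearMap.mul' k A).dualMap f)) (a ⊗ₜ b)

theorem dualTriple_tmul (f : Dual k A) (s : Dual k A ⊗[k] Dual k A) (a b c : A) :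
    dualTriple k A (f ⊗ₜ s) (a ⊗ₜ (b ⊗ₜ c)) = f a * dualDistrib k A A s (b ⊗ₜ c) := rfl

theorem dualTriple_assoc (s : Dual k A ⊗[k] Dual k A) (g : Dual k A) (a b c : A) :
    dualTriple k A (TensorProduct.assoc k _ _ _ (s ⊗ₜ g)) (a ⊗ₜ (b ⊗ₜ c)) =
      dualDistrib k A A s (a ⊗ₜ b) * g c := by
  induction s using TensorProduct.induction_on with
  | zero => simp
  | tmul x y => simp [dualTriple_tmul, mul_assoc]
  | add x y hx hy => simp only [TensorProduct.add_tmul, map_add, LinearMap.add_apply, hx, hy,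
      add_mul]

theorem dual_coassoc_left (t : Dual k A ⊗[k] Dual k A) (a b c : A) :
    dualTriple k A (TensorProduct.assoc k _ _ _ ((dualComul k A).rTensor _ t))
      (a ⊗ₜ (b ⊗ₜ c)) = dualDistrib k A A t ((a * b) ⊗ₜ c) := by
  induction t using TensorProduct.induction_on with
  | zero => simp
  | tmul x y => simp [dualTriple_assoc, dualDistrib_dualComul]
  | add x y hx hy => simp only [map_add, LinearMap.add_apply, hx, hy]

theorem dual_coassoc_right (t : Dual k A ⊗[k] Dual k A) (a b c : A) :
    dualTriple k A ((dualComul k A).lTensor _ t)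
      (a ⊗ₜ (b ⊗ₜ c)) = dualDistrib k A A t (a ⊗ₜ (b * c)) := by
  induction t using TensorProduct.induction_on with
  | zero => simp
  | tmul x y => simp [dualTriple_tmul, dualDistrib_dualComul]
  | add x y hx hy => simp only [map_add, LinearMap.add_apply, hx, hy]

theorem dual_counit_left (t : Dual k A ⊗[k] Dual k A) (a : A) :
    TensorProduct.lid k _ ((dualCounit k A).rTensor _ t) a = dualDistrib k A A t (1 ⊗ₜ a) := by
  induction t using TensorProduct.induction_on with
  | zero => simp
  | tmul x y => simp [dualCounit]
  | add x y hx hy => simp only [map_add, LinearMap.add_apply, hx, hy]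

theorem dual_counit_right (t : Dual k A ⊗[k] Dual k A) (a : A) :
    TensorProduct.rid k _ ((dualCounit k A).lTensor _ t) a = dualDistrib k A A t (a ⊗ₜ 1) := by
  induction t using TensorProduct.induction_on with
  | zero => simp
  | tmul x y => simp [dualCounit, mul_comm]
  | add x y hx hy => simp only [map_add, LinearMap.add_apply, hx, hy]

variable (k A) in
/-- The coalgebra `DA` dual to the finite-dimensional algebra `A`. -/
instance dualCoalgebra : Coalgebra k (Dual k A) where
  comul := dualComul k A
  counit := dualCounit k A
  coassoc := by
    refine LinearMap.ext fun f => (dualTriple k A).injective ?_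
    ext a b c
    exact (dual_coassoc_left _ a b c).trans (by
      rw [dualDistrib_dualComul, mul_assoc, ← dualDistrib_dualComul]
      exact (dual_coassoc_right _ a b c).symm)
  rTensor_counit_comp_comul := by
    refine LinearMap.ext fun f => (TensorProduct.lid k (Dual k A)).injective ?_
    ext a
    exact (dual_counit_left _ a).trans (by simp [dualDistrib_dualComul])
  lTensor_counit_comp_comul := by
    refine LinearMap.ext fun f => (TensorProduct.rid k (Dual k A)).injective ?_
    ext a
    exact (dual_counit_right _ a).trans (by simp [dualDistrib_dualComul])

section RightComodule

variable (k A) (M : Type u) [AddCommGroup M] [Module k M]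

/-- The isomorphism `M ⊗ DA ≅ Hom(A, M)`. -/
def tensorDualEquiv : M ⊗[k] Dual k A ≃ₗ[k] (A →ₗ[k] M) :=
  TensorProduct.comm k M (Dual k A) ≪≫ₗ dualTensorHomEquiv k A M

/-- The isomorphism `M ⊗ (DA ⊗ DA) ≅ Hom(A ⊗ A, M)`. -/
def tensorDualDualEquiv : M ⊗[k] (Dual k A ⊗[k] Dual k A) ≃ₗ[k] (A ⊗[k] A →ₗ[k] M) :=
  TensorProduct.congr (LinearEquiv.refl k M) (dualDistribEquiv k A A) ≪≫ₗ
    TensorProduct.comm k M _ ≪≫ₗ dualTensorHomEquiv k (A ⊗[k] A) M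

variable {k A M}

theorem tensorDualEquiv_tmul (m : M) (f : Dual k A) (a : A) :
    tensorDualEquiv k A M (m ⊗ₜ f) a = f a • m := rfl

theorem tensorDualDualEquiv_tmul (m : M) (s : Dual k A ⊗[k] Dual k A) (a b : A) :
    tensorDualDualEquiv k A M (m ⊗ₜ s) (a ⊗ₜ b) = dualDistrib k A A s (a ⊗ₜ b) • m := rfl

theorem tensorDualDualEquiv_assoc (s : M ⊗[k] Dual k A) (g : Dual k A) (a b : A) :
    tensorDualDualEquiv k A M (TensorProduct.assoc k _ _ _ (s ⊗ₜ g)) (a ⊗ₜ b) =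
      g b • tensorDualEquiv k A M s a := by
  induction s using TensorProduct.induction_on with
  | zero => simp
  | tmul x y => simp [tensorDualDualEquiv_tmul, tensorDualEquiv_tmul, smul_smul, mul_comm]
  | add x y hx hy => simp only [TensorProduct.add_tmul, map_add, LinearMap.add_apply, hx, hy,
      smul_add]

theorem rcoact_coassoc_right (t : M ⊗[k] Dual k A) (a b : A) :
    tensorDualDualEquiv k A M ((dualComul k A).lTensor _ t) (a ⊗ₜ b) =
      tensorDualEquiv k A M t (a * b) := by
  induction t using TensorProduct.induction_on with
  | zero => simp
  | tmul x y =>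
    rw [LinearMap.lTensor_tmul, tensorDualDualEquiv_tmul, dualDistrib_dualComul,
      tensorDualEquiv_tmul]
  | add x y hx hy => simp only [map_add, LinearMap.add_apply, hx, hy]

theorem rcoact_counit (t : M ⊗[k] Dual k A) :
    TensorProduct.rid k M ((dualCounit k A).lTensor M t) = tensorDualEquiv k A M t 1 := by
  induction t using TensorProduct.induction_on with
  | zero => simp
  | tmul x y => simp [dualCounit, tensorDualEquiv_tmul]
  | add x y hx hy => simp only [map_add, LinearMap.add_apply, hx, hy]

theorem tensorDualEquiv_rTensor {M' : Type u} [AddCommGroup M'] [Module k M'] (f : M →ₗ[k] M')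
    (t : M ⊗[k] Dual k A) (a : A) :
    tensorDualEquiv k A M' (f.rTensor _ t) a = f (tensorDualEquiv k A M t a) := by
  induction t using TensorProduct.induction_on with
  | zero => simp
  | tmul x y => simp [tensorDualEquiv_tmul]
  | add x y hx hy => simp only [map_add, LinearMap.add_apply, hx, hy]

variable [Module A M] [IsScalarTower k A M]

variable (k A M) in
/-- The structure map `M → Hom(A, M) ≅ M ⊗ DA` of a left `A`-module `M`, `Δ m = (a ↦ a m)`. -/
def rcoact : M →ₗ[k] M ⊗[k] Dual k A :=
  (tensorDualEquiv k A M).symm.toLinearMap ∘ₗ (Algebra.lsmul k k M : A →ₐ[k] _).toLinearMap.flip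

theorem tensorDualEquiv_rcoact (m : M) (a : A) :
    tensorDualEquiv k A M (rcoact k A M m) a = a • m :=
  LinearMap.congr_fun ((tensorDualEquiv k A M).apply_symm_apply _) a

theorem rcoact_coassoc_left (t : M ⊗[k] Dual k A) (a b : A) :
    tensorDualDualEquiv k A M (TensorProduct.assoc k _ _ _ ((rcoact k A M).rTensor _ t))
      (a ⊗ₜ b) = a • tensorDualEquiv k A M t b := by
  induction t using TensorProduct.induction_on with
  | zero => simp
  | tmul x y =>
    rw [LinearMap.rTensor_tmul, tensorDualDualEquiv_assoc, tensorDualEquiv_rcoact,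
      tensorDualEquiv_tmul, smul_algebra_smul_comm]
  | add x y hx hy => simp only [map_add, LinearMap.add_apply, hx, hy, smul_add]

variable (k A M) in
theorem rcoact_coassoc :
    (TensorProduct.assoc k M (Dual k A) (Dual k A)).toLinearMap ∘ₗ
        (rcoact k A M).rTensor (Dual k A) ∘ₗ rcoact k A M =
      (dualComul k A).lTensor M ∘ₗ rcoact k A M := by
  refine LinearMap.ext fun m => (tensorDualDualEquiv k A M).injective ?_
  ext a b
  exact (rcoact_coassoc_left _ a b).trans (by
    rw [tensorDualEquiv_rcoact, smul_smul, ← tensorDualEquiv_rcoact (k := k)]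
    exact (rcoact_coassoc_right _ a b).symm)

end RightComodule

section LeftComodule

variable (k A) (N : Type u) [AddCommGroup N] [Module k N]

/-- The isomorphism `(DA ⊗ DA) ⊗ N ≅ Hom(A ⊗ A, N)`. -/
def dualDualTensorEquiv : (Dual k A ⊗[k] Dual k A) ⊗[k] N ≃ₗ[k] (A ⊗[k] A →ₗ[k] N) :=
  TensorProduct.congr (dualDistribEquiv k A A) (LinearEquiv.refl k N) ≪≫ₗ
    dualTensorHomEquiv k (A ⊗[k] A) N

variable {k A N}

theorem dualDualTensorEquiv_tmul (s : Dual k A ⊗[k] Dual k A) (n : N) (a b : A) :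
    dualDualTensorEquiv k A N (s ⊗ₜ n) (a ⊗ₜ b) = dualDistrib k A A s (a ⊗ₜ b) • n := rfl

theorem dualDualTensorEquiv_assoc (f : Dual k A) (s : Dual k A ⊗[k] N) (a b : A) :
    dualDualTensorEquiv k A N ((TensorProduct.assoc k _ _ _).symm (f ⊗ₜ s)) (a ⊗ₜ b) =
      f a • dualTensorHom k A N s b := by
  induction s using TensorProduct.induction_on with
  | zero => simp
  | tmul x y => simp [dualDualTensorEquiv_tmul, smul_smul]
  | add x y hx hy => simp only [TensorProduct.tmul_add, map_add, LinearMap.add_apply, hx, hy,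
      smul_add]

theorem lcoact_coassoc_left (t : Dual k A ⊗[k] N) (a b : A) :
    dualDualTensorEquiv k A N ((dualComul k A).rTensor _ t) (a ⊗ₜ b) =
      dualTensorHom k A N t (a * b) := by
  induction t using TensorProduct.induction_on with
  | zero => simp
  | tmul x y =>
    rw [LinearMap.rTensor_tmul, dualDualTensorEquiv_tmul, dualDistrib_dualComul,
      dualTensorHom_apply]
  | add x y hx hy => simp only [map_add, LinearMap.add_apply, hx, hy]

theorem lcoact_counit (t : Dual k A ⊗[k] N) :
    TensorProduct.lid k N ((dualCounit k A).rTensor N t) = dualTensorHom k A N t 1 := by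
  induction t using TensorProduct.induction_on with
  | zero => simp
  | tmul x y => simp [dualCounit]
  | add x y hx hy => simp only [map_add, LinearMap.add_apply, hx, hy]

theorem dualTensorHom_lTensor {N' : Type u} [AddCommGroup N'] [Module k N'] (g : N →ₗ[k] N')
    (t : Dual k A ⊗[k] N) (a : A) :
    dualTensorHom k A N' (g.lTensor _ t) a = g (dualTensorHom k A N t a) := by
  induction t using TensorProduct.induction_on with
  | zero => simp
  | tmul x y => simp
  | add x y hx hy => simp only [map_add, LinearMap.add_apply, hx, hy]

variable [Module Aᵐᵒᵖ N] [IsScalarTower k Aᵐᵒᵖ N]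

variable (k A N) in
/-- The structure map `N → Hom(A, N) ≅ DA ⊗ N` of a right `A`-module `N`, `Δ n = (a ↦ n a)`. -/
def lcoact : N →ₗ[k] Dual k A ⊗[k] N :=
  (dualTensorHomEquiv k A N).symm.toLinearMap ∘ₗ
    ((Algebra.lsmul k k N : Aᵐᵒᵖ →ₐ[k] _).toLinearMap ∘ₗ
      (MulOpposite.opLinearEquiv k : A ≃ₗ[k] Aᵐᵒᵖ).toLinearMap).flip

theorem dualTensorHom_lcoact (n : N) (a : A) :
    dualTensorHom k A N (lcoact k A N n) a = MulOpposite.op a • n :=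
  LinearMap.congr_fun ((dualTensorHomEquiv k A N).apply_symm_apply _) a

theorem lcoact_coassoc_right (t : Dual k A ⊗[k] N) (a b : A) :
    dualDualTensorEquiv k A N
      ((TensorProduct.assoc k _ _ _).symm ((lcoact k A N).lTensor _ t)) (a ⊗ₜ b) =
      MulOpposite.op b • dualTensorHom k A N t a := by
  induction t using TensorProduct.induction_on with
  | zero => simp
  | tmul x y =>
    rw [LinearMap.lTensor_tmul, dualDualTensorEquiv_assoc, dualTensorHom_lcoact,
      dualTensorHom_apply, smul_algebra_smul_comm]
  | add x y hx hy => simp only [map_add, LinearMap.add_apply, hx, hy, smul_add]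

variable (k A N) in
theorem lcoact_coassoc :
    (TensorProduct.assoc k (Dual k A) (Dual k A) N).toLinearMap ∘ₗ
        (dualComul k A).rTensor N ∘ₗ lcoact k A N =
      (lcoact k A N).lTensor (Dual k A) ∘ₗ lcoact k A N := by
  have h : (dualComul k A).rTensor N ∘ₗ lcoact k A N =
      (TensorProduct.assoc k (Dual k A) (Dual k A) N).symm.toLinearMap ∘ₗ
        (lcoact k A N).lTensor (Dual k A) ∘ₗ lcoact k A N := by
    refine LinearMap.ext fun n => (dualDualTensorEquiv k A N).injective ?_
    ext a b
    refine (lcoact_coassoc_left _ a b).trans (Eq.trans ?_ (lcoact_coassoc_right _ a b).symm)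
    rw [dualTensorHom_lcoact, dualTensorHom_lcoact, MulOpposite.op_mul, mul_smul]
  rw [h]
  exact LinearMap.ext fun n => LinearEquiv.apply_symm_apply
    (TensorProduct.assoc k (Dual k A) (Dual k A) N) _

end LeftComodule

/-! ### Modules as comodules, and bimodules -/

open scoped ModuleCat

section Functors

variable (k A)

/-- The functor from left `A`-modules to right `DA`-comodules, with `Δ m = (a ↦ a m)` in
`Hom(A, M) ≅ M ⊗ DA`. -/
def toRComod : ModuleCat.{u} A ⥤ RComod k (Dual k A) where
  obj M :=
    letI : Module k M := ModuleCat.moduleOfAlgebraModule M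
    { carrier := M
      coact := rcoact k A M
      coassoc := rcoact_coassoc k A M
      counit := LinearMap.ext fun m => (rcoact_counit _).trans (by simp [tensorDualEquiv_rcoact]) }
  map {M M'} f :=
    letI : Module k M := ModuleCat.moduleOfAlgebraModule M
    letI : Module k M' := ModuleCat.moduleOfAlgebraModule M'
    ⟨f.hom.restrictScalars k, by
      refine LinearMap.ext fun m => (tensorDualEquiv k A M').injective ?_
      ext a
      exact (tensorDualEquiv_rcoact _ a).trans (.trans (by
        rw [tensorDualEquiv_rcoact]; exact (f.hom.map_smul a m).symm)
        (tensorDualEquiv_rTensor (f.hom.restrictScalars k) (rcoact k A M m) a).symm)⟩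

/-- The functor from right `A`-modules to left `DA`-comodules, with `Δ n = (a ↦ n a)` in
`Hom(A, N) ≅ DA ⊗ N`. -/
def toLComod : ModuleCat.{u} Aᵐᵒᵖ ⥤ LComod k (Dual k A) where
  obj N :=
    letI : Module k N := ModuleCat.moduleOfAlgebraModule N
    { carrier := N
      coact := lcoact k A N
      coassoc := lcoact_coassoc k A N
      counit := LinearMap.ext fun n => (lcoact_counit _).trans (by simp [dualTensorHom_lcoact]) }
  map {N N'} g :=
    letI : Module k N := ModuleCat.moduleOfAlgebraModule N
    letI : Module k N' := ModuleCat.moduleOfAlgebraModule N'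
    ⟨g.hom.restrictScalars k, by
      refine LinearMap.ext fun n => (dualTensorHomEquiv k A N').injective ?_
      ext a
      exact (dualTensorHom_lcoact _ a).trans (.trans (by
        rw [dualTensorHom_lcoact]; exact (g.hom.map_smul (MulOpposite.op a) n).symm)
        (dualTensorHom_lTensor (g.hom.restrictScalars k) (lcoact k A N n) a).symm)⟩

/-- The enveloping algebra `A^e = A ⊗ A^op`, whose left modules are the `A`-bimodules. -/
abbrev Env := A ⊗[k] Aᵐᵒᵖ

/-- The `A`-bimodule `A`, with `(a ⊗ b) x = a x b`. -/
def regularBimod : ModuleCat.{u} (Env k A) :=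
  letI : Module (Env k A) A := TensorProduct.Algebra.module
  ModuleCat.of (Env k A) A

/-- The action of `A^e` on `M ⊗ N` for a left `A`-module `M` and a right `A`-module `N`,
`(a ⊗ b) (m ⊗ n) = a m ⊗ n b`. -/
def outerAction (M N : Type u) [AddCommGroup M] [Module k M] [Module A M] [IsScalarTower k A M]
    [AddCommGroup N] [Module k N] [Module Aᵐᵒᵖ N] [IsScalarTower k Aᵐᵒᵖ N] :
    Env k A →ₐ[k] Module.End k (M ⊗[k] N) :=
  (Module.endTensorEndAlgHom (R := k) (S := k) (A := k) (M := M) (N := N)).comp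
    (Algebra.TensorProduct.map (Algebra.lsmul k k M) (Algebra.lsmul k k N))

/-- The `A`-bimodule `M ⊗ N`, with `a (m ⊗ n) b = a m ⊗ n b`. -/
def outerObj (M : ModuleCat.{u} A) (N : ModuleCat.{u} Aᵐᵒᵖ) : ModuleCat.{u} (Env k A) :=
  letI : Module (Env k A) (M ⊗[k] N) :=
    Module.compHom (M ⊗[k] N) (outerAction k A M N).toRingHom
  ModuleCat.of (Env k A) (M ⊗[k] N)

/-- The bimodule map `f ⊗ g : M ⊗ N → M' ⊗ N'`. -/
def outerMap {M M' : ModuleCat.{u} A} {N N' : ModuleCat.{u} Aᵐᵒᵖ} (f : M ⟶ M') (g : N ⟶ N') :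
    outerObj k A M N ⟶ outerObj k A M' N' :=
  letI : Module (Env k A) (M ⊗[k] N) :=
    Module.compHom (M ⊗[k] N) (outerAction k A M N).toRingHom
  letI : Module (Env k A) (M' ⊗[k] N') :=
    Module.compHom (M' ⊗[k] N') (outerAction k A M' N').toRingHom
  ModuleCat.ofHom
    { toFun := TensorProduct.map (f.hom.restrictScalars k) (g.hom.restrictScalars k)
      map_add' := map_add _
      map_smul' := fun r x => by
        change TensorProduct.map _ _ (outerAction k A M N r x) =
          outerAction k A M' N' r (TensorProduct.map _ _ x)
        induction r using TensorProduct.induction_on with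
        | zero => simp only [map_zero, LinearMap.zero_apply]
        | add r s hr hs => simp only [map_add, LinearMap.add_apply, hr, hs]
        | tmul a b =>
          induction x using TensorProduct.induction_on with
          | zero => simp only [map_zero]
          | add x y hx hy => simp only [map_add, hx, hy]
          | tmul m n =>
            exact congrArg₂ (fun x y => x ⊗ₜ[k] y) (f.hom.map_smul a m) (g.hom.map_smul b n) }

variable {A}

/-- Hochschild cohomology `H^n(A, B) = Ext^n_{A^e}(A, B)` with coefficients in the bimodule `B`. -/
abbrev Hochschild (B : ModuleCat.{u} (Env k A)) (n : ℕ) : Type u :=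
  Abelian.Ext (regularBimod k A) B n

/-- The map on Hochschild cohomology induced by a bimodule map. -/
def hochschildMap {B B' : ModuleCat.{u} (Env k A)} (β : B ⟶ B') (n : ℕ) :
    Hochschild k B n → Hochschild k B' n :=
  fun x => x.comp (Abelian.Ext.mk₀ β) (add_zero n)

end Functors

end Dual

end

/-! Since `A` is finite-dimensional, `X ⊗ DA ≅ Hom(A, X)`. A right `DA`-comodule is therefore the
same thing as a left `A`-module: coassociativity evaluated at `a ⊗ b` is associativity of the
action, and the counit axiom says that `1` acts as the identity. The same holds on the other side.
So `toRComod` and `toLComod` are equivalences, and the comodule categories are abelian with enough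
injectives. This gives the resolutions and the lifts.

Applied to the defining map of `M □ N`, evaluation at `a` gives `am ⊗ n - m ⊗ na`. Hence `M □ N`
consists of the `z` in `M ⊗ N` with `az = za` for all `a`. Such a `z` is the image of `1` under a
unique bimodule map `A → M ⊗ N`, so `M □ N ≅ Hom_{A^e}(A, M ⊗ N)` naturally (`homEquivCotensor`,
`cotensorIso_naturality`).

Carry the comodule resolutions back to injective resolutions `P` of `M` and `Q` of `N` by modules.
The total complex of `I □ J` becomes `Hom_{A^e}(A, Tot(P ⊗ Q))`, and it remains to see that `Tot(P ⊗
Q)` is an injective resolution of `M ⊗ N` over `A^e`.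

Exactness (`quasiIso_mapBifunctorMap_outer`): over the field `k` the augmentations of `P` and `Q`
are homotopy equivalences, and the tensor product of complexes preserves these. Injectivity
(`injective_outerObj`): a module is injective exactly when it splits off its coinduced module
`Hom_k(B, M)`, and tensoring the two splittings gives one over `A^e` because `Hom_k(A, M) ⊗
Hom_k(A^op, N) ≅ Hom_k(A^e, M ⊗ N)` in finite dimension.

The cohomology of `Hom(A, R)` for an injective resolution `R` is `Ext` (`homologyEquivExt`). Each
identification commutes with maps of resolutions, which gives naturality. -/

noncomputable section

/-! ### Comparison of total complexes of two bifunctors -/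

namespace HomologicalComplex

variable {C₁ C₂ D₁ D₂ D E I₁ I₂ J : Type*} [Category* C₁] [Category* C₂] [Category* D₁]
  [Category* D₂] [Category* D] [Category* E] [Preadditive C₁] [Preadditive C₂]
  [Preadditive D₁] [Preadditive D₂] [Preadditive D] [Preadditive E]
  {c₁ : ComplexShape I₁} {c₂ : ComplexShape I₂}

/-- Isomorphisms `T(K₁, K₂) ≅ F(G(L₁, L₂))` in all bidegrees that are compatible with the
differentials. -/
structure BifunctorComparison (T : C₁ ⥤ C₂ ⥤ E) (G : D₁ ⥤ D₂ ⥤ D) (F : D ⥤ E)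
    (K₁ : HomologicalComplex C₁ c₁) (K₂ : HomologicalComplex C₂ c₂)
    (L₁ : HomologicalComplex D₁ c₁) (L₂ : HomologicalComplex D₂ c₂) where
  iso (i₁ : I₁) (i₂ : I₂) :
    (T.obj (K₁.X i₁)).obj (K₂.X i₂) ≅ F.obj ((G.obj (L₁.X i₁)).obj (L₂.X i₂))
  comm₁ (i₁ i₁' : I₁) (i₂ : I₂) :
    (T.map (K₁.d i₁ i₁')).app (K₂.X i₂) ≫ (iso i₁' i₂).hom =
      (iso i₁ i₂).hom ≫ F.map ((G.map (L₁.d i₁ i₁')).app (L₂.X i₂))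
  comm₂ (i₁ : I₁) (i₂ i₂' : I₂) :
    (T.obj (K₁.X i₁)).map (K₂.d i₂ i₂') ≫ (iso i₁ i₂').hom =
      (iso i₁ i₂).hom ≫ F.map ((G.obj (L₁.X i₁)).map (L₂.d i₂ i₂'))

namespace BifunctorComparison

variable {T : C₁ ⥤ C₂ ⥤ E} [T.PreservesZeroMorphisms] [∀ X, (T.obj X).PreservesZeroMorphisms]
  {G : D₁ ⥤ D₂ ⥤ D} [G.PreservesZeroMorphisms] [∀ X, (G.obj X).PreservesZeroMorphisms]
  {F : D ⥤ E}
  {K₁ : HomologicalComplex C₁ c₁} {K₂ : HomologicalComplex C₂ c₂}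
  {L₁ : HomologicalComplex D₁ c₁} {L₂ : HomologicalComplex D₂ c₂}
  (α : BifunctorComparison T G F K₁ K₂ L₁ L₂)
  (c : ComplexShape J) [DecidableEq J] [TotalComplexShape c₁ c₂ c]
  [HasMapBifunctor K₁ K₂ T c] [HasMapBifunctor L₁ L₂ G c]

/-- The comparison map `Tot T(K₁, K₂) ⟶ F(Tot G(L₁, L₂))` in a given degree. -/
def homX (j : J) : (mapBifunctor K₁ K₂ T c).X j ⟶ F.obj ((mapBifunctor L₁ L₂ G c).X j) :=
  mapBifunctorDesc fun i₁ i₂ h => (α.iso i₁ i₂).hom ≫ F.map (ιMapBifunctor L₁ L₂ G c i₁ i₂ j h)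

@[simp]
lemma ι_homX (i₁ : I₁) (i₂ : I₂) (j : J) (h : ComplexShape.π c₁ c₂ c ⟨i₁, i₂⟩ = j) :
    ιMapBifunctor K₁ K₂ T c i₁ i₂ j h ≫ α.homX c j =
      (α.iso i₁ i₂).hom ≫ F.map (ιMapBifunctor L₁ L₂ G c i₁ i₂ j h) :=
  ι_mapBifunctorDesc _ _ _ _

/-- An additive functor preserves finite coproducts. As only finitely many bidegrees have total
degree `j`, the image under `F` of the total object is again a coproduct, and the inverse is
assembled from the inverses of the `α.iso`. -/
lemma isIso_homX [F.Additive] (j : J) [Finite (ComplexShape.π c₁ c₂ c ⁻¹' {j})] :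
    IsIso (α.homX c j) := by
  let X := (((G.mapBifunctorHomologicalComplex c₁ c₂).obj L₁).obj L₂).toGradedObject
  let hc := isColimitCofanMkObjOfIsColimit F _
    (fun i : ComplexShape.π c₁ c₂ c ⁻¹' {j} => X.ιMapObj (ComplexShape.π c₁ c₂ c) i.1 j i.2)
    (show IsColimit (Cofan.mk _ _) from X.isColimitCofanMapObj (ComplexShape.π c₁ c₂ c) j)
  obtain ⟨inv, hinv⟩ : ∃ inv : F.obj ((mapBifunctor L₁ L₂ G c).X j) ⟶ (mapBifunctor K₁ K₂ T c).X j,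
      ∀ (i₁ : I₁) (i₂ : I₂) (h : ComplexShape.π c₁ c₂ c ⟨i₁, i₂⟩ = j),
        F.map (ιMapBifunctor L₁ L₂ G c i₁ i₂ j h) ≫ inv =
          (α.iso i₁ i₂).inv ≫ ιMapBifunctor K₁ K₂ T c i₁ i₂ j h :=
    ⟨Cofan.IsColimit.desc hc fun i => (α.iso i.1.1 i.1.2).inv ≫
        ιMapBifunctor K₁ K₂ T c i.1.1 i.1.2 j i.2,
      fun i₁ i₂ h => Cofan.IsColimit.fac hc _ ⟨(i₁, i₂), h⟩⟩
  refine ⟨inv, mapBifunctor.hom_ext fun i₁ i₂ h => ?_, Cofan.IsColimit.hom_ext hc _ _ fun i => ?_⟩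
  · rw [reassoc_of% α.ι_homX c, hinv, Iso.hom_inv_id_assoc, Category.comp_id]
  · obtain ⟨⟨i₁, i₂⟩, (h : ComplexShape.π c₁ c₂ c ⟨i₁, i₂⟩ = j)⟩ := i
    have hi : F.map (ιMapBifunctor L₁ L₂ G c i₁ i₂ j h) ≫ inv ≫ α.homX c j =
        F.map (ιMapBifunctor L₁ L₂ G c i₁ i₂ j h) := by
      rw [← Category.assoc, hinv, Category.assoc, ι_homX, Iso.inv_hom_id_assoc]
    exact hi.trans (Category.comp_id _).symm

variable [F.Additive]

lemma ιOrZero_homX (i₁ : I₁) (i₂ : I₂) (j : J) :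
    ιMapBifunctorOrZero K₁ K₂ T c i₁ i₂ j ≫ α.homX c j =
      (α.iso i₁ i₂).hom ≫ F.map (ιMapBifunctorOrZero L₁ L₂ G c i₁ i₂ j) := by
  by_cases h : ComplexShape.π c₁ c₂ c ⟨i₁, i₂⟩ = j
  · rw [ιMapBifunctorOrZero_eq _ _ _ _ _ _ _ h, ιMapBifunctorOrZero_eq _ _ _ _ _ _ _ h, ι_homX]
  · rw [ιMapBifunctorOrZero_eq_zero _ _ _ _ _ _ _ h, ιMapBifunctorOrZero_eq_zero _ _ _ _ _ _ _ h,
      zero_comp, F.map_zero, comp_zero]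

/-- The sign in the total differential depends only on the bidegree, so it is the same on both
sides, and an additive functor commutes with it. -/
lemma d₁_homX (i₁ : I₁) (i₂ : I₂) (j : J) :
    mapBifunctor.d₁ K₁ K₂ T c i₁ i₂ j ≫ α.homX c j =
      (α.iso i₁ i₂).hom ≫ F.map (mapBifunctor.d₁ L₁ L₂ G c i₁ i₂ j) := by
  by_cases h : c₁.Rel i₁ (c₁.next i₁)
  · rw [mapBifunctor.d₁_eq' _ _ _ _ h, mapBifunctor.d₁_eq' _ _ _ _ h, F.map_units_smul,
      Linear.units_smul_comp, Linear.comp_units_smul, Category.assoc, ιOrZero_homX,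
      reassoc_of% α.comm₁, F.map_comp]
  · rw [mapBifunctor.d₁_eq_zero _ _ _ _ _ _ _ h, mapBifunctor.d₁_eq_zero _ _ _ _ _ _ _ h,
      zero_comp, F.map_zero, comp_zero]

lemma d₂_homX (i₁ : I₁) (i₂ : I₂) (j : J) :
    mapBifunctor.d₂ K₁ K₂ T c i₁ i₂ j ≫ α.homX c j =
      (α.iso i₁ i₂).hom ≫ F.map (mapBifunctor.d₂ L₁ L₂ G c i₁ i₂ j) := by
  by_cases h : c₂.Rel i₂ (c₂.next i₂)
  · rw [mapBifunctor.d₂_eq' _ _ _ _ _ h, mapBifunctor.d₂_eq' _ _ _ _ _ h, F.map_units_smul,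
      Linear.units_smul_comp, Linear.comp_units_smul, Category.assoc, ιOrZero_homX,
      reassoc_of% α.comm₂, F.map_comp]
  · rw [mapBifunctor.d₂_eq_zero _ _ _ _ _ _ _ h, mapBifunctor.d₂_eq_zero _ _ _ _ _ _ _ h,
      zero_comp, F.map_zero, comp_zero]

/-- The comparison map `Tot T(K₁, K₂) ⟶ F(Tot G(L₁, L₂))`. -/
def hom : mapBifunctor K₁ K₂ T c ⟶ (F.mapHomologicalComplex c).obj (mapBifunctor L₁ L₂ G c) where
  f := α.homX c
  comm' j j' _ := by
    refine mapBifunctor.hom_ext fun i₁ i₂ h => ?_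
    change ιMapBifunctor K₁ K₂ T c i₁ i₂ j h ≫ α.homX c j ≫
        F.map ((mapBifunctor L₁ L₂ G c).d j j') =
      ιMapBifunctor K₁ K₂ T c i₁ i₂ j h ≫ (mapBifunctor K₁ K₂ T c).d j j' ≫ α.homX c j'
    rw [reassoc_of% α.ι_homX c, mapBifunctor.d_eq, mapBifunctor.d_eq, Preadditive.add_comp,
      Preadditive.comp_add, mapBifunctor.ι_D₁_assoc, mapBifunctor.ι_D₂_assoc, d₁_homX, d₂_homX,
      ← F.map_comp, Preadditive.comp_add, mapBifunctor.ι_D₁, mapBifunctor.ι_D₂, F.map_add,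
      Preadditive.comp_add]

instance isIso_hom [∀ j, Finite (ComplexShape.π c₁ c₂ c ⁻¹' {j})] : IsIso (α.hom c) :=
  have (j : J) : IsIso ((α.hom c).f j) := α.isIso_homX c j
  Hom.isIso_of_components _

variable {K₁' : HomologicalComplex C₁ c₁} {K₂' : HomologicalComplex C₂ c₂}
  {L₁' : HomologicalComplex D₁ c₁} {L₂' : HomologicalComplex D₂ c₂}
  (α' : BifunctorComparison T G F K₁' K₂' L₁' L₂')
  [HasMapBifunctor K₁' K₂' T c] [HasMapBifunctor L₁' L₂' G c]

lemma hom_naturality (f₁ : K₁ ⟶ K₁') (f₂ : K₂ ⟶ K₂') (g₁ : L₁ ⟶ L₁') (g₂ : L₂ ⟶ L₂')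
    (h₁ : ∀ i₁ i₂, (T.map (f₁.f i₁)).app (K₂.X i₂) ≫ (T.obj (K₁'.X i₁)).map (f₂.f i₂) ≫
      (α'.iso i₁ i₂).hom =
      (α.iso i₁ i₂).hom ≫ F.map ((G.map (g₁.f i₁)).app (L₂.X i₂) ≫
        (G.obj (L₁'.X i₁)).map (g₂.f i₂))) :
    mapBifunctorMap f₁ f₂ T c ≫ α'.hom c =
      α.hom c ≫ (F.mapHomologicalComplex c).map (mapBifunctorMap g₁ g₂ G c) := by
  refine HomologicalComplex.hom_ext _ _ fun j => mapBifunctor.hom_ext fun i₁ i₂ h => ?_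
  change ιMapBifunctor K₁ K₂ T c i₁ i₂ j h ≫ (mapBifunctorMap f₁ f₂ T c).f j ≫ α'.homX c j =
    ιMapBifunctor K₁ K₂ T c i₁ i₂ j h ≫ α.homX c j ≫ F.map ((mapBifunctorMap g₁ g₂ G c).f j)
  rw [ι_mapBifunctorMap_assoc, ι_homX, reassoc_of% α.ι_homX c, ← F.map_comp, ι_mapBifunctorMap,
    reassoc_of% h₁ i₁ i₂, ← F.map_comp, Category.assoc]

end BifunctorComparison

end HomologicalComplex

instance finite_preimage_up_π (j : ℕ) :
    Finite (ComplexShape.π (ComplexShape.up ℕ) (ComplexShape.up ℕ) (ComplexShape.up ℕ) ⁻¹' {j}) :=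
  Set.Finite.to_subtype (((Set.finite_Iic j).prod (Set.finite_Iic j)).subset fun i hi => by
    have : i.1 + i.2 = j := hi
    exact ⟨by simp; lia, by simp; lia⟩)

/-! ### Ext as the cohomology of Hom into an injective resolution -/

namespace CategoryTheory.InjectiveResolution

open Abelian

universe w v u₁

variable {C : Type u₁} [Category.{v} C] [Abelian C] {X Y : C} (R : InjectiveResolution Y)

/-- Extended by zero to negative degrees, the resolution has nothing in degree `-1`, so there are no
nonzero coboundaries in degree `0`. -/
lemma extMk_zero_eq_zero_iff [HasExt.{w} C] (f : X ⟶ R.cocomplex.X 0) (m : ℕ) (hm : 0 + 1 = m)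
    (hf : f ≫ R.cocomplex.d 0 m = 0) : R.extMk f m hm hf = 0 ↔ f = 0 := by
  refine ⟨fun h => ?_, by rintro rfl; simp⟩
  rw [← R.extEquivCohomologyClass.apply_eq_iff_eq, extEquivCohomologyClass_extMk,
    extEquivCohomologyClass_zero, CochainComplex.HomComplex.CohomologyClass.mk_eq_zero_iff,
    CochainComplex.HomComplex.Cocycle.fromSingleMk_mem_coboundaries_iff _ _ _ _ _ (-1) (by simp)]
    at h
  obtain ⟨g, hg⟩ := h
  have hz : IsZero (R.cochainComplex.X (-1)) :=
    R.cochainComplex.isZero_of_isStrictlyGE 0 (-1) (by lia)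
  rw [hz.eq_of_tgt g 0, zero_comp] at hg
  rw [← cancel_mono (R.cochainComplexXIso 0 0 rfl).inv, zero_comp]
  exact hg.symm

variable (k : Type*) [CommRing k] [Linear k C]

/-- Scaling a cocycle is precomposition with `r • 𝟙 X`, and both `extMk` and the composition of
`Ext` classes are compatible with that. -/
lemma smul_extMk [HasExt.{w} C] {n : ℕ} (r : k) (f : X ⟶ R.cocomplex.X n) (m : ℕ) (hm : n + 1 = m)
    (hf : f ≫ R.cocomplex.d n m = 0) :
    R.extMk (r • f) m hm (by rw [Linear.smul_comp, hf, smul_zero]) = r • R.extMk f m hm hf := by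
  have h := R.mk₀_comp_extMk f m hm hf (r • 𝟙 X)
  rw [Ext.mk₀_smul, Ext.smul_comp, Ext.mk₀_id_comp] at h
  simp only [Linear.smul_comp, Category.id_comp] at h
  exact h.symm

variable (X)

/-- The complex `Hom(X, R)` for an injective resolution `R`. -/
abbrev homComplex : CochainComplex (ModuleCat.{v} k) ℕ :=
  (((linearCoyoneda k C).obj (Opposite.op X)).mapHomologicalComplex _).obj R.cocomplex

variable (n : ℕ)

/-- The morphism underlying a cocycle of `Hom(X, R)`. -/
def cyclesHom : (R.homComplex X k).cycles n →ₗ[k] (X ⟶ R.cocomplex.X n) :=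
  ((R.homComplex X k).iCycles n).hom

lemma cyclesHom_injective : Function.Injective (R.cyclesHom X k n) :=
  (ModuleCat.mono_iff_injective ((R.homComplex X k).iCycles n)).1 inferInstance

lemma cyclesHom_comp_d (z : (R.homComplex X k).cycles n) :
    R.cyclesHom X k n z ≫ R.cocomplex.d n (n + 1) = 0 :=
  LinearMap.congr_fun (ModuleCat.hom_ext_iff.1 ((R.homComplex X k).iCycles_d n (n + 1))) z

lemma exists_cyclesHom_eq (f : X ⟶ R.cocomplex.X n) (hf : f ≫ R.cocomplex.d n (n + 1) = 0) :
    ∃ z, R.cyclesHom X k n z = f := by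
  have hex := ShortComplex.exact_of_f_is_kernel (ShortComplex.mk _ _
    ((R.homComplex X k).iCycles_d n (n + 1))) ((R.homComplex X k).cyclesIsKernel n _ (by simp))
  rw [ShortComplex.moduleCat_exact_iff] at hex
  exact hex f hf

lemma homologyπ_surjective :
    Function.Surjective ((R.homComplex X k).homologyπ n).hom :=
  (ModuleCat.epi_iff_surjective _).1 inferInstance

/-- Using `prev n` instead of `n - 1` covers degree `0` as well, where the incoming differential is
zero. -/
lemma homologyπ_eq_zero_iff (z : (R.homComplex X k).cycles n) :
    ((R.homComplex X k).homologyπ n).hom z = 0 ↔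
      ∃ g : X ⟶ R.cocomplex.X ((ComplexShape.up ℕ).prev n),
        g ≫ R.cocomplex.d _ n = R.cyclesHom X k n z := by
  have hex := ShortComplex.exact_of_g_is_cokernel (ShortComplex.mk _ _
    ((R.homComplex X k).toCycles_comp_homologyπ _ n)) ((R.homComplex X k).homologyIsCokernel _ n rfl)
  rw [ShortComplex.moduleCat_exact_iff] at hex
  have hi (g) : R.cyclesHom X k n (((R.homComplex X k).toCycles _ n).hom g) =
      show X ⟶ R.cocomplex.X n from g ≫ R.cocomplex.d ((ComplexShape.up ℕ).prev n) n :=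
    LinearMap.congr_fun (ModuleCat.hom_ext_iff.1
      ((R.homComplex X k).toCycles_i ((ComplexShape.up ℕ).prev n) n)) g
  constructor
  · intro h
    obtain ⟨g, rfl⟩ := hex z h
    exact ⟨g, (hi g).symm⟩
  · rintro ⟨g, hg⟩
    obtain rfl := R.cyclesHom_injective X k n (hg.symm.trans (hi g).symm)
    exact LinearMap.congr_fun (ModuleCat.hom_ext_iff.1
      ((R.homComplex X k).toCycles_comp_homologyπ _ n)) g

variable [HasExt.{w} C]

/-- The map from the cocycles of `Hom(X, R)` to `Ext(X, Y)`. -/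
def cyclesToExt : (R.homComplex X k).cycles n →ₗ[k] Ext X Y n where
  toFun z := R.extMk (R.cyclesHom X k n z) (n + 1) rfl (R.cyclesHom_comp_d X k n z)
  map_add' z z' := by
    rw [R.add_extMk]
    congr 1
    exact map_add _ _ _
  map_smul' r z := by
    rw [RingHom.id_apply, ← R.smul_extMk]
    congr 1
    exact map_smul _ _ _

lemma cyclesToExt_surjective : Function.Surjective (R.cyclesToExt X k n) := fun α => by
  obtain ⟨f, hf, rfl⟩ := R.extMk_surjective α (n + 1) rfl
  obtain ⟨z, rfl⟩ := R.exists_cyclesHom_eq X k n f hf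
  exact ⟨z, rfl⟩

/-- Both quotients of the cocycles kill exactly the coboundaries. Since both maps are surjective,
cohomology and `Ext` are the same quotient, and this is what makes `homologyEquivExt` possible. -/
lemma ker_cyclesToExt :
    LinearMap.ker (R.cyclesToExt X k n) = LinearMap.ker ((R.homComplex X k).homologyπ n).hom := by
  ext z
  rw [LinearMap.mem_ker, LinearMap.mem_ker, homologyπ_eq_zero_iff]
  cases n with
  | zero =>
    refine (R.extMk_zero_eq_zero_iff _ _ rfl (R.cyclesHom_comp_d X k 0 z)).trans ?_
    -- In degree `0` the incoming differential is zero, so being a coboundary means being zero.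
    have hd : R.cocomplex.d ((ComplexShape.up ℕ).prev 0) 0 = 0 :=
      R.cocomplex.shape _ _ (by simp)
    rw [hd]
    exact ⟨fun h => ⟨0, by rw [h, comp_zero]⟩, fun ⟨g, hg⟩ => hg.symm.trans comp_zero⟩
  | succ p =>
    rw [CochainComplex.prev_nat_succ]
    exact R.extMk_eq_zero_iff _ _ rfl (R.cyclesHom_comp_d X k (p + 1) z) p rfl

/-- The cohomology of `Hom(X, R)` is `Ext(X, Y)`. -/
def homologyEquivExt : (R.homComplex X k).homology n ≃ₗ[k] Ext X Y n :=
  (LinearMap.quotKerEquivOfSurjective _ (R.homologyπ_surjective X k n)).symm ≪≫ₗ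
    Submodule.quotEquivOfEq _ _ (R.ker_cyclesToExt X k n).symm ≪≫ₗ
    LinearMap.quotKerEquivOfSurjective _ (R.cyclesToExt_surjective X k n)

lemma homologyEquivExt_π (z : (R.homComplex X k).cycles n) :
    R.homologyEquivExt X k n (((R.homComplex X k).homologyπ n).hom z) = R.cyclesToExt X k n z := by
  have : (LinearMap.quotKerEquivOfSurjective _ (R.homologyπ_surjective X k n)).symm
      (((R.homComplex X k).homologyπ n).hom z) = Submodule.Quotient.mk z :=
    (LinearEquiv.symm_apply_eq _).2 rfl
  exact congrArg (fun y => LinearMap.quotKerEquivOfSurjective _ (R.cyclesToExt_surjective X k n)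
    (Submodule.quotEquivOfEq _ _ (R.ker_cyclesToExt X k n).symm y)) this

/-- Every cohomology class has a cocycle representative, and on representatives both sides are given
by composition with `φ.hom.f n`. -/
lemma homologyEquivExt_naturality {Y' : C} {R' : InjectiveResolution Y'} {g : Y ⟶ Y'}
    (φ : Hom R R' g) (x : (R.homComplex X k).homology n) :
    R'.homologyEquivExt X k n ((HomologicalComplex.homologyMap
      ((((linearCoyoneda k C).obj (Opposite.op X)).mapHomologicalComplex _).map φ.hom) n).hom x) =
      (R.homologyEquivExt X k n x).comp (Ext.mk₀ g) (add_zero n) := by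
  obtain ⟨z, rfl⟩ := R.homologyπ_surjective X k n x
  let ψ := (((linearCoyoneda k C).obj (Opposite.op X)).mapHomologicalComplex _).map φ.hom
  have h₁ : (HomologicalComplex.homologyMap ψ n).hom (((R.homComplex X k).homologyπ n).hom z) =
      ((R'.homComplex X k).homologyπ n).hom ((HomologicalComplex.cyclesMap ψ n).hom z) :=
    LinearMap.congr_fun (ModuleCat.hom_ext_iff.1 (HomologicalComplex.homologyπ_naturality ψ n)) z
  have h₂ : R'.cyclesHom X k n ((HomologicalComplex.cyclesMap ψ n).hom z) =
      R.cyclesHom X k n z ≫ φ.hom.f n :=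
    LinearMap.congr_fun (ModuleCat.hom_ext_iff.1 (HomologicalComplex.cyclesMap_i ψ n)) z
  rw [homologyEquivExt_π]
  refine (congrArg _ h₁).trans ?_
  rw [homologyEquivExt_π]
  refine Eq.trans ?_ (R.extMk_comp_mk₀ _ _ rfl (R.cyclesHom_comp_d X k n z) φ).symm
  change R'.extMk _ _ rfl (R'.cyclesHom_comp_d X k n _) = _
  congr 1

end CategoryTheory.InjectiveResolution

/-! ### Comodules over the dual coalgebra are modules -/

section ComodulesAsModules

open Module
open scoped ModuleCat

variable {k A : Type u} [Field k] [Ring A] [Algebra k A] [Module.Finite k A]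

namespace RComod

/-- Valid for an arbitrary linear `Δ`: with `a • m` read off from `Δ`, the iterated coaction
evaluates to `a • (b • m)`. This turns coassociativity into associativity of the action. -/
lemma tensorDualDualEquiv_assoc_rTensor {M : Type u} [AddCommGroup M] [Module k M]
    (Δ : M →ₗ[k] M ⊗[k] Dual k A) (t : M ⊗[k] Dual k A) (a b : A) :
    tensorDualDualEquiv k A M (TensorProduct.assoc k _ _ _ (Δ.rTensor _ t)) (a ⊗ₜ b) =
      tensorDualEquiv k A M (Δ (tensorDualEquiv k A M t b)) a := by
  induction t using TensorProduct.induction_on with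
  | zero => simp
  | tmul x y =>
    rw [LinearMap.rTensor_tmul, tensorDualDualEquiv_assoc, tensorDualEquiv_tmul, map_smul,
      map_smul, LinearMap.smul_apply]
  | add x y hx hy => simp only [map_add, LinearMap.add_apply, hx, hy]

/-- The left `A`-module structure on a right `DA`-comodule. -/
@[reducible]
def moduleOfDual (X : RComod k (Dual k A)) : Module A X.carrier where
  smul a m := tensorDualEquiv k A X.carrier (X.coact m) a
  one_smul m := (rcoact_counit _).symm.trans (LinearMap.congr_fun X.counit m)
  mul_smul a b m := by
    have h := congrArg (fun t => tensorDualDualEquiv k A X.carrier t (a ⊗ₜ b))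
      (LinearMap.congr_fun X.coassoc m)
    exact ((rcoact_coassoc_right _ a b).symm.trans h.symm).trans
      (tensorDualDualEquiv_assoc_rTensor X.coact (X.coact m) a b)
  smul_zero a := by
    change tensorDualEquiv k A X.carrier (X.coact 0) a = 0
    simp
  smul_add a m m' := by
    change tensorDualEquiv k A X.carrier (X.coact (m + m')) a = _
    simp only [map_add, LinearMap.add_apply]
    rfl
  add_smul a b m := map_add _ a b
  zero_smul m := map_zero _

lemma tensorDualEquiv_coact_lin {X Y : RComod k (Dual k A)} (f : X ⟶ Y) (m : X.carrier) (a : A) :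
    tensorDualEquiv k A Y.carrier (Y.coact (Hom.lin f m)) a =
      Hom.lin f (tensorDualEquiv k A X.carrier (X.coact m) a) :=
  (congrArg (fun t => tensorDualEquiv k A Y.carrier t a) (LinearMap.congr_fun f.2 m)).trans
    (tensorDualEquiv_rTensor (Hom.lin f) (X.coact m) a)

/-- Construct a comodule map from a linear map that commutes with the evaluated coactions. -/
def homMk {X Y : RComod k (Dual k A)} (f : X.carrier →ₗ[k] Y.carrier)
    (hf : ∀ m a, tensorDualEquiv k A Y.carrier (Y.coact (f m)) a =
      f (tensorDualEquiv k A X.carrier (X.coact m) a)) : X ⟶ Y :=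
  ⟨f, LinearMap.ext fun m => (tensorDualEquiv k A Y.carrier).injective <| LinearMap.ext fun a =>
    (hf m a).trans (tensorDualEquiv_rTensor f (X.coact m) a).symm⟩

/-- The left `A`-module associated with a right `DA`-comodule. -/
def toModuleCat (X : RComod k (Dual k A)) : ModuleCat.{u} A :=
  letI := X.moduleOfDual
  ModuleCat.of A X.carrier

/-- A comodule is the comodule of its associated module. -/
def toModuleCatEquiv (X : RComod k (Dual k A)) :
    ((toRComod k A).obj X.toModuleCat).carrier ≃ₗ[k] X.carrier :=
  { AddEquiv.refl X.carrier with
    map_smul' := fun r (m : X.carrier) => by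
      -- The source has scalars restricted along `algebraMap k A`, the target its original ones.
      -- They agree because `1` acts as the identity, which is the counit axiom.
      change tensorDualEquiv k A X.carrier (X.coact m) (algebraMap k A r) = r • m
      rw [Algebra.algebraMap_eq_smul_one, map_smul]
      exact congrArg (r • ·) (letI := X.moduleOfDual; one_smul A m) }

/-- A comodule is the comodule of its associated module. -/
def toModuleCatIso (X : RComod k (Dual k A)) : (toRComod k A).obj X.toModuleCat ≅ X where
  hom := homMk X.toModuleCatEquiv.toLinearMap fun m a =>
    letI := ModuleCat.moduleOfAlgebraModule (k := k) X.toModuleCat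
    (tensorDualEquiv_rcoact (k := k) (M := X.toModuleCat) m a).symm
  inv := homMk X.toModuleCatEquiv.symm.toLinearMap fun m a =>
    letI := ModuleCat.moduleOfAlgebraModule (k := k) X.toModuleCat
    (tensorDualEquiv_rcoact (k := k) (M := X.toModuleCat) m a)
  hom_inv_id := rfl
  inv_hom_id := rfl

instance : (toRComod k A).Additive where
  map_add := rfl

instance : (toRComod k A).Faithful where
  map_injective h := ModuleCat.hom_ext (LinearMap.ext fun m =>
    LinearMap.congr_fun (Subtype.ext_iff.1 h) m)

instance : (toRComod k A).Full where
  map_surjective {M M'} f :=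
    letI := ModuleCat.moduleOfAlgebraModule (k := k) M
    letI := ModuleCat.moduleOfAlgebraModule (k := k) M'
    ⟨ModuleCat.ofHom { (Hom.lin f) with
      map_smul' := fun a m => ((tensorDualEquiv_rcoact (k := k) (M := M') (Hom.lin f m) a).symm.trans
        ((tensorDualEquiv_coact_lin f m a).trans
          (congrArg (Hom.lin f) (tensorDualEquiv_rcoact (k := k) (M := M) m a)))).symm }, rfl⟩

instance : (toRComod k A).EssSurj where
  mem_essImage X := ⟨X.toModuleCat, ⟨X.toModuleCatIso⟩⟩

/-- Fullness says that a comodule map is linear for the evaluated action, and essential surjectivity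
is `toModuleCatIso`. The abelian structure and the injectives below are transported along this
equivalence. -/
instance : (toRComod k A).IsEquivalence where

instance : HasFiniteProducts (RComod k (Dual k A)) where
  out _ := Adjunction.hasLimitsOfShape_of_equivalence (toRComod k A).inv

instance : Abelian (RComod k (Dual k A)) := abelianOfEquivalence (toRComod k A).inv

instance : EnoughInjectives (RComod k (Dual k A)) :=
  EnoughInjectives.of_equivalence (toRComod k A).inv

end RComod

namespace LComod

lemma dualDualTensorEquiv_assoc_lTensor {N : Type u} [AddCommGroup N] [Module k N]
    (Δ : N →ₗ[k] Dual k A ⊗[k] N) (t : Dual k A ⊗[k] N) (a b : A) :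
    dualDualTensorEquiv k A N ((TensorProduct.assoc k _ _ _).symm (Δ.lTensor _ t)) (a ⊗ₜ b) =
      dualTensorHom k A N (Δ (dualTensorHom k A N t a)) b := by
  induction t using TensorProduct.induction_on with
  | zero => simp
  | tmul x y =>
    rw [LinearMap.lTensor_tmul, dualDualTensorEquiv_assoc, dualTensorHom_apply, map_smul,
      map_smul, LinearMap.smul_apply]
  | add x y hx hy => simp only [map_add, LinearMap.add_apply, hx, hy]

/-- The right `A`-module structure on a left `DA`-comodule. -/
@[reducible]
def moduleOfDual (X : LComod k (Dual k A)) : Module Aᵐᵒᵖ X.carrier where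
  smul a n := dualTensorHom k A X.carrier (X.coact n) a.unop
  one_smul n := (lcoact_counit _).symm.trans (LinearMap.congr_fun X.counit n)
  mul_smul a b n := by
    -- Multiplication in `Aᵐᵒᵖ` is reversed, so coassociativity is evaluated at `b ⊗ a`.
    have h := congrArg (fun t => dualDualTensorEquiv k A X.carrier
      ((TensorProduct.assoc k _ _ _).symm t) (b.unop ⊗ₜ a.unop)) (LinearMap.congr_fun X.coassoc n)
    simp only [LinearMap.comp_apply, LinearEquiv.coe_coe, LinearEquiv.symm_apply_apply] at h
    exact ((lcoact_coassoc_left _ b.unop a.unop).symm.trans h).trans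
      (dualDualTensorEquiv_assoc_lTensor X.coact (X.coact n) b.unop a.unop)
  smul_zero a := by
    change dualTensorHom k A X.carrier (X.coact 0) a.unop = 0
    simp
  smul_add a m m' := by
    change dualTensorHom k A X.carrier (X.coact (m + m')) a.unop = _
    simp only [map_add, LinearMap.add_apply]
    rfl
  add_smul a b m := map_add _ a.unop b.unop
  zero_smul m := map_zero _

lemma dualTensorHom_coact_lin {X Y : LComod k (Dual k A)} (f : X ⟶ Y) (n : X.carrier) (a : A) :
    dualTensorHom k A Y.carrier (Y.coact (Hom.lin f n)) a =
      Hom.lin f (dualTensorHom k A X.carrier (X.coact n) a) :=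
  (congrArg (fun t => dualTensorHom k A Y.carrier t a) (LinearMap.congr_fun f.2 n)).trans
    (dualTensorHom_lTensor (Hom.lin f) (X.coact n) a)

/-- Construct a comodule map from a linear map that commutes with the evaluated coactions. -/
def homMk {X Y : LComod k (Dual k A)} (f : X.carrier →ₗ[k] Y.carrier)
    (hf : ∀ n a, dualTensorHom k A Y.carrier (Y.coact (f n)) a =
      f (dualTensorHom k A X.carrier (X.coact n) a)) : X ⟶ Y :=
  ⟨f, LinearMap.ext fun n => (dualTensorHomEquiv k A Y.carrier).injective <| LinearMap.ext fun a =>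
    (hf n a).trans (dualTensorHom_lTensor f (X.coact n) a).symm⟩

/-- The right `A`-module associated with a left `DA`-comodule. -/
def toModuleCat (X : LComod k (Dual k A)) : ModuleCat.{u} Aᵐᵒᵖ :=
  letI := X.moduleOfDual
  ModuleCat.of Aᵐᵒᵖ X.carrier

/-- A comodule is the comodule of its associated module. -/
def toModuleCatEquiv (X : LComod k (Dual k A)) :
    ((toLComod k A).obj X.toModuleCat).carrier ≃ₗ[k] X.carrier :=
  { AddEquiv.refl X.carrier with
    map_smul' := fun r (n : X.carrier) => by
      change dualTensorHom k A X.carrier (X.coact n) (algebraMap k A r) = r • n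
      rw [Algebra.algebraMap_eq_smul_one, map_smul]
      exact congrArg (r • ·) (letI := X.moduleOfDual; one_smul Aᵐᵒᵖ n) }

/-- A comodule is the comodule of its associated module. -/
def toModuleCatIso (X : LComod k (Dual k A)) : (toLComod k A).obj X.toModuleCat ≅ X where
  hom := homMk X.toModuleCatEquiv.toLinearMap fun n a =>
    letI := ModuleCat.moduleOfAlgebraModule (k := k) X.toModuleCat
    (dualTensorHom_lcoact (k := k) (N := X.toModuleCat) n a).symm
  inv := homMk X.toModuleCatEquiv.symm.toLinearMap fun n a =>
    letI := ModuleCat.moduleOfAlgebraModule (k := k) X.toModuleCat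
    (dualTensorHom_lcoact (k := k) (N := X.toModuleCat) n a)
  hom_inv_id := rfl
  inv_hom_id := rfl

instance : (toLComod k A).Additive where
  map_add := rfl

instance : (toLComod k A).Faithful where
  map_injective h := ModuleCat.hom_ext (LinearMap.ext fun m =>
    LinearMap.congr_fun (Subtype.ext_iff.1 h) m)

instance : (toLComod k A).Full where
  map_surjective {N N'} f :=
    letI := ModuleCat.moduleOfAlgebraModule (k := k) N
    letI := ModuleCat.moduleOfAlgebraModule (k := k) N'
    ⟨ModuleCat.ofHom { (Hom.lin f) with
      map_smul' := fun a n =>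
        ((dualTensorHom_lcoact (k := k) (N := N') (Hom.lin f n) a.unop).symm.trans
          ((dualTensorHom_coact_lin f n a.unop).trans
            (congrArg (Hom.lin f)
              (dualTensorHom_lcoact (k := k) (N := N) n a.unop)))).symm }, rfl⟩

instance : (toLComod k A).EssSurj where
  mem_essImage X := ⟨X.toModuleCat, ⟨X.toModuleCatIso⟩⟩

instance : (toLComod k A).IsEquivalence where

instance : HasFiniteProducts (LComod k (Dual k A)) where
  out _ := Adjunction.hasLimitsOfShape_of_equivalence (toLComod k A).inv

instance : Abelian (LComod k (Dual k A)) := abelianOfEquivalence (toLComod k A).inv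

instance : EnoughInjectives (LComod k (Dual k A)) :=
  EnoughInjectives.of_equivalence (toLComod k A).inv

end LComod

end ComodulesAsModules

/-! ### Lifts, and transport of injective resolutions along equivalences -/

section InjectiveResolutions

variable {𝒞 : Type*} [Category* 𝒞] [Abelian 𝒞]

lemma exists_isLiftOf {X Y : 𝒞} (f : X ⟶ Y) (I : InjectiveResolution X)
    (J : InjectiveResolution Y) : ∃ φ : I.cocomplex ⟶ J.cocomplex, IsLiftOf φ f :=
  ⟨InjectiveResolution.desc f J I, InjectiveResolution.desc_commutes f J I⟩

variable {𝒟 : Type*} [Category* 𝒟] [Abelian 𝒟]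

namespace CategoryTheory.InjectiveResolution

/-- The image of an injective resolution under an exact functor, provided that it consists of
injective objects. -/
def mapOfInjective {X : 𝒟} (I : InjectiveResolution X) (F : 𝒟 ⥤ 𝒞) [F.Additive]
    [F.PreservesHomology] (hI : ∀ n, Injective (F.obj (I.cocomplex.X n))) :
    InjectiveResolution (F.obj X) where
  cocomplex := (F.mapHomologicalComplex _).obj I.cocomplex
  injective := hI
  ι := (HomologicalComplex.singleMapHomologicalComplex F (ComplexShape.up ℕ) 0).inv.app X ≫
    (F.mapHomologicalComplex _).map I.ι
  quasiIso := by
    have : QuasiIso ((F.mapHomologicalComplex _).map I.ι) := inferInstance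
    exact quasiIso_comp _ _

lemma isLiftOf_mapOfInjective {X Y : 𝒟} {f : X ⟶ Y} {I : InjectiveResolution X}
    {J : InjectiveResolution Y} {φ : I.cocomplex ⟶ J.cocomplex} (F : 𝒟 ⥤ 𝒞) [F.Additive]
    [F.PreservesHomology] (hI : ∀ n, Injective (F.obj (I.cocomplex.X n)))
    (hJ : ∀ n, Injective (F.obj (J.cocomplex.X n))) (hφ : IsLiftOf φ f) :
    IsLiftOf (I := I.mapOfInjective F hI) (J := J.mapOfInjective F hJ)
      ((F.mapHomologicalComplex _).map φ) (F.map f) := by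
  let s := (HomologicalComplex.singleMapHomologicalComplex F (ComplexShape.up ℕ) 0).inv
  have h : (CochainComplex.single₀ 𝒞).map (F.map f) ≫ s.app Y =
    s.app X ≫ (F.mapHomologicalComplex _).map ((CochainComplex.single₀ 𝒟).map f) := s.naturality f
  change (s.app X ≫ (F.mapHomologicalComplex _).map I.ι) ≫ (F.mapHomologicalComplex _).map φ =
    (CochainComplex.single₀ 𝒞).map (F.map f) ≫ s.app Y ≫ (F.mapHomologicalComplex _).map J.ι
  rw [reassoc_of% h, ← Functor.map_comp, ← (hφ : I.ι ≫ φ = _)]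
  exact (Category.assoc _ _ _).trans (congrArg (s.app X ≫ ·) (Functor.map_comp _ _ _).symm)

/-- Replace the resolved object of an injective resolution by an isomorphic one. -/
def ofIso {X Y : 𝒞} (e : X ≅ Y) (I : InjectiveResolution Y) : InjectiveResolution X where
  cocomplex := I.cocomplex
  ι := (CochainComplex.single₀ 𝒞).map e.hom ≫ I.ι
  quasiIso := by
    have : QuasiIso I.ι := inferInstance
    have : IsIso ((CochainComplex.single₀ 𝒞).map e.hom) := inferInstance
    exact quasiIso_comp _ _

lemma isLiftOf_ofIso {X X' Y Y' : 𝒞} {e : X ≅ Y} {e' : X' ≅ Y'} {I : InjectiveResolution Y}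
    {J : InjectiveResolution Y'} {f : X ⟶ X'} {g : Y ⟶ Y'} (h : f ≫ e'.hom = e.hom ≫ g)
    {φ : I.cocomplex ⟶ J.cocomplex} (hφ : IsLiftOf φ g) :
    IsLiftOf (I := I.ofIso e) (J := J.ofIso e') φ f := by
  change ((CochainComplex.single₀ 𝒞).map e.hom ≫ I.ι) ≫ φ =
    (CochainComplex.single₀ 𝒞).map f ≫ (CochainComplex.single₀ 𝒞).map e'.hom ≫ J.ι
  rw [← Functor.map_comp_assoc, h, Functor.map_comp_assoc, ← (hφ : I.ι ≫ φ = _)]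
  exact Category.assoc _ _ _

variable (F : 𝒟 ⥤ 𝒞) [F.Additive] [F.IsEquivalence]

instance : F.inv.Additive :=
  have : F.asEquivalence.functor.Additive := ‹F.Additive›
  F.asEquivalence.inverse_additive

/-- The injective resolution of `X` given by an injective resolution of `F(X)`, for an equivalence
of categories `F`. -/
def ofEquivalence {X : 𝒟} (I : InjectiveResolution (F.obj X)) : InjectiveResolution X :=
  ofIso (F.asEquivalence.unitIso.app X) (I.mapOfInjective F.inv fun n =>
    (F.asEquivalence.symm.map_injective_iff _).2 (I.injective n))

/-- The transported augmentation involves the unit of the equivalence, so being a lift is preserved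
by naturality of the unit. -/
lemma isLiftOf_ofEquivalence {X Y : 𝒟} (f : X ⟶ Y) {I : InjectiveResolution (F.obj X)}
    {J : InjectiveResolution (F.obj Y)} {φ : I.cocomplex ⟶ J.cocomplex}
    (hφ : IsLiftOf φ (F.map f)) :
    IsLiftOf (I := I.ofEquivalence F) (J := J.ofEquivalence F)
      ((F.inv.mapHomologicalComplex _).map φ) f :=
  isLiftOf_ofIso (I := I.mapOfInjective F.inv _) (J := J.mapOfInjective F.inv _)
    (F.asEquivalence.unit.naturality f)
    (isLiftOf_mapOfInjective F.inv _ _ hφ)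

end CategoryTheory.InjectiveResolution

end InjectiveResolutions

/-- For use when only the inverse has an explicit formula: in `cotensorIso` it is evaluation at `1`,
for which naturality is immediate. -/
lemma CategoryTheory.Iso.square_of_inv {𝒞 : Type*} [Category* 𝒞] {X X' Y Y' : 𝒞} {a : X ⟶ X'}
    {b : Y ⟶ Y'} (e : X ≅ Y) (e' : X' ≅ Y') (h : e.inv ≫ a = b ≫ e'.inv) :
    a ≫ e'.hom = e.hom ≫ b := by
  rw [← Iso.inv_comp_eq, ← Category.assoc, h, Category.assoc, e'.inv_hom_id, Category.comp_id]

/-! ### The cotensor product as bimodule maps out of `A` -/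

section CotensorHom

open Module
open scoped ModuleCat

section Unbundled

variable {k A : Type u} [Field k] [Ring A] [Algebra k A]
  {M N : Type u} [AddCommGroup M] [Module k M] [AddCommGroup N] [Module k N]

variable (M N) in
/-- Evaluation at `a` as a map `M ⊗ (DA ⊗ N) → M ⊗ N`. -/
def tensorEval (a : A) : M ⊗[k] (Dual k A ⊗[k] N) →ₗ[k] M ⊗[k] N :=
  (LinearMap.applyₗ a ∘ₗ dualTensorHom k A N).lTensor M

@[simp]
lemma tensorEval_tmul (a : A) (m : M) (s : Dual k A ⊗[k] N) :
    tensorEval M N a (m ⊗ₜ s) = m ⊗ₜ dualTensorHom k A N s a := rfl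

section

variable [Module A M] [IsScalarTower k A M] [Module Aᵐᵒᵖ N] [IsScalarTower k Aᵐᵒᵖ N]

lemma outerAction_tmul (a : A) (b : Aᵐᵒᵖ) (m : M) (n : N) :
    outerAction k A M N (a ⊗ₜ b) (m ⊗ₜ n) = (a • m) ⊗ₜ (b • n) := rfl

lemma outerAction_mul_tmul (a a' : A) (b b' : Aᵐᵒᵖ) (z : M ⊗[k] N) :
    outerAction k A M N ((a * a') ⊗ₜ (b * b')) z =
      outerAction k A M N (a ⊗ₜ b) (outerAction k A M N (a' ⊗ₜ b') z) := by
  rw [← Algebra.TensorProduct.tmul_mul_tmul, map_mul, Module.End.mul_apply]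

end

variable [Module.Finite k A]

lemma tensorEval_assoc (a : A) (t : M ⊗[k] Dual k A) (n : N) :
    tensorEval M N a (TensorProduct.assoc k _ _ _ (t ⊗ₜ n)) = tensorDualEquiv k A M t a ⊗ₜ n := by
  induction t using TensorProduct.induction_on with
  | zero => simp
  | tmul x f => simp [tensorDualEquiv_tmul, TensorProduct.smul_tmul]
  | add x y hx hy => simp only [TensorProduct.add_tmul, map_add, LinearMap.add_apply, hx, hy]

/-- In finite dimension `M ⊗ (DA ⊗ N) ≅ Hom(A, M ⊗ N)`, so an element is determined by its
evaluations at all `a`. -/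
lemma eq_zero_of_tensorEval (w : M ⊗[k] (Dual k A ⊗[k] N))
    (hw : ∀ a : A, tensorEval M N a w = 0) : w = 0 := by
  have h (w : M ⊗[k] (Dual k A ⊗[k] N)) (a : A) :
      dualTensorHomEquiv k A (M ⊗[k] N) (TensorProduct.leftComm k M (Dual k A) N w) a =
        tensorEval M N a w := by
    induction w using TensorProduct.induction_on with
    | zero => simp
    | tmul m s =>
      induction s using TensorProduct.induction_on with
      | zero => simp
      | tmul f n => simp
      | add x y hx hy => simp only [TensorProduct.tmul_add, map_add, LinearMap.add_apply, hx, hy]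
    | add x y hx hy => simp only [map_add, LinearMap.add_apply, hx, hy]
  refine (TensorProduct.leftComm k M (Dual k A) N).injective
    ((dualTensorHomEquiv k A (M ⊗[k] N)).injective (LinearMap.ext fun a => ?_))
  rw [h, hw]
  simp

variable [Module A M] [IsScalarTower k A M] [Module Aᵐᵒᵖ N] [IsScalarTower k Aᵐᵒᵖ N]

lemma tensorEval_coact (a : A) (z : M ⊗[k] N) :
    tensorEval M N a (TensorProduct.assoc k M (Dual k A) N ((rcoact k A M).rTensor N z) -
      (lcoact k A N).lTensor M z) =
    outerAction k A M N (a ⊗ₜ 1) z - outerAction k A M N (1 ⊗ₜ MulOpposite.op a) z := by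
  induction z using TensorProduct.induction_on with
  | zero => simp
  | tmul m n =>
    rw [map_sub, LinearMap.rTensor_tmul, LinearMap.lTensor_tmul, tensorEval_assoc,
      tensorDualEquiv_rcoact, tensorEval_tmul, dualTensorHom_lcoact, outerAction_tmul,
      outerAction_tmul, one_smul, one_smul]
  | add x y hx hy =>
    simp only [map_add, add_sub_add_comm, hx, hy]

/-- Evaluating the `DA` factor at `a` gives `az - za`, and these evaluations detect zero. So the
cotensor product is the space of central elements of `M ⊗ N`. -/
lemma coact_eq_iff (z : M ⊗[k] N) :
    TensorProduct.assoc k M (Dual k A) N ((rcoact k A M).rTensor N z) -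
      (lcoact k A N).lTensor M z = 0 ↔
    ∀ a : A, outerAction k A M N (a ⊗ₜ 1) z = outerAction k A M N (1 ⊗ₜ MulOpposite.op a) z := by
  refine ⟨fun h a => sub_eq_zero.1 ?_, fun h => eq_zero_of_tensorEval _ fun a => ?_⟩
  · rw [← tensorEval_coact, h, map_zero]
  · rw [tensorEval_coact, h, sub_self]

end Unbundled

variable (k A : Type u) [Field k] [Ring A] [Algebra k A]

section Outer

variable {k A}
variable {M M' M'' : ModuleCat.{u} A} {N N' N'' : ModuleCat.{u} Aᵐᵒᵖ}

/-- The identity map from `M ⊗ N` to the underlying vector space of the bimodule. -/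
def outerMk (M : ModuleCat.{u} A) (N : ModuleCat.{u} Aᵐᵒᵖ) : M ⊗[k] N ≃ₗ[k] outerObj k A M N :=
  { AddEquiv.refl (M ⊗[k] N) with
    map_smul' := fun r x => by
      change r • x = outerAction k A M N (algebraMap k (Env k A) r) x
      rw [AlgHom.commutes]
      rfl }

lemma smul_outerMk (r : Env k A) (x : M ⊗[k] N) :
    r • outerMk M N x = outerMk M N (outerAction k A M N r x) := rfl

lemma outerObj_hom_ext {X : ModuleCat.{u} (Env k A)} {f g : outerObj k A M N ⟶ X}
    (h : ∀ m n, f.hom (outerMk M N (m ⊗ₜ n)) = g.hom (outerMk M N (m ⊗ₜ n))) : f = g := by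
  refine ModuleCat.hom_ext (LinearMap.ext fun x => ?_)
  obtain ⟨x, rfl⟩ := (outerMk M N).surjective x
  induction x using TensorProduct.induction_on with
  | zero => simp only [map_zero]
  | tmul m n => exact h m n
  | add x y hx hy => simp only [map_add, hx, hy]

lemma outerMap_id : outerMap k A (𝟙 M) (𝟙 N) = 𝟙 _ :=
  outerObj_hom_ext fun _ _ => rfl

lemma outerMap_comp (f : M ⟶ M') (f' : M' ⟶ M'') (g : N ⟶ N') (g' : N' ⟶ N'') :
    outerMap k A f g ≫ outerMap k A f' g' = outerMap k A (f ≫ f') (g ≫ g') :=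
  outerObj_hom_ext fun _ _ => rfl

lemma outerMap_add_left (f f' : M ⟶ M') (g : N ⟶ N') :
    outerMap k A (f + f') g = outerMap k A f g + outerMap k A f' g :=
  outerObj_hom_ext fun m n => congrArg (outerMk M' N')
    (TensorProduct.add_tmul (R := k) (f.hom m) (f'.hom m) (g.hom n))

lemma outerMap_add_right (f : M ⟶ M') (g g' : N ⟶ N') :
    outerMap k A f (g + g') = outerMap k A f g + outerMap k A f g' :=
  outerObj_hom_ext fun m n => congrArg (outerMk M' N')
    (TensorProduct.tmul_add (R := k) (f.hom m) (g.hom n) (g'.hom n))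

end Outer

/-- The bifunctor sending a left and a right `A`-module to the bimodule `M ⊗ N`. -/
def outer : ModuleCat.{u} A ⥤ ModuleCat.{u} Aᵐᵒᵖ ⥤ ModuleCat.{u} (Env k A) where
  obj M :=
    { obj := fun N => outerObj k A M N
      map := fun g => outerMap k A (𝟙 M) g
      map_id := fun _ => outerMap_id
      map_comp := fun g g' => by rw [outerMap_comp, Category.comp_id] }
  map f :=
    { app := fun N => outerMap k A f (𝟙 N)
      naturality := fun _ _ _ => outerObj_hom_ext fun _ _ => rfl }
  map_id M := by ext N : 2; exact outerMap_id
  map_comp f f' := by ext N : 2; exact outerObj_hom_ext fun _ _ => rfl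

instance : (outer k A).Additive where
  map_add {_ _ f f'} := by ext N : 2; exact outerMap_add_left f f' (𝟙 N)

instance (M : ModuleCat.{u} A) : ((outer k A).obj M).Additive where
  map_add {_ _ g g'} := outerMap_add_right (𝟙 M) g g'

variable {k A}

variable (k A) in
/-- The identity map from `A` to the underlying group of the bimodule `A`. -/
def regularMk : A ≃+ regularBimod k A := AddEquiv.refl A

lemma smul_regularMk (a : A) (b : Aᵐᵒᵖ) (x : A) :
    (a ⊗ₜ b : Env k A) • regularMk k A x = regularMk k A (a * (x * b.unop)) := rfl

lemma regularMk_eq_smul (x : A) :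
    regularMk k A x = (x ⊗ₜ 1 : Env k A) • regularMk k A 1 := by
  rw [smul_regularMk, MulOpposite.unop_one, one_mul, mul_one]

lemma smul_regularMk_one (a : A) :
    (1 ⊗ₜ MulOpposite.op a : Env k A) • regularMk k A 1 = (a ⊗ₜ 1 : Env k A) • regularMk k A 1 := by
  rw [smul_regularMk, smul_regularMk, MulOpposite.unop_one, MulOpposite.unop_op, one_mul, one_mul,
    one_mul, mul_one]

/-- The bimodule `A` is generated by `1`. -/
lemma regularBimod_hom_ext {X : ModuleCat.{u} (Env k A)} {f g : regularBimod k A ⟶ X}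
    (h : f.hom (regularMk k A 1) = g.hom (regularMk k A 1)) : f = g := by
  refine ModuleCat.hom_ext (LinearMap.ext fun x => ?_)
  obtain ⟨x, rfl⟩ := (regularMk k A).surjective x
  rw [regularMk_eq_smul, map_smul, map_smul, h]

variable {M M' : ModuleCat.{u} A} {N N' : ModuleCat.{u} Aᵐᵒᵖ}

/-- The bimodule map `A → M ⊗ N` given by a central element of `M ⊗ N`. -/
def homOfCentral (z : M ⊗[k] N) (hz : ∀ a : A, outerAction k A M N (a ⊗ₜ 1) z =
    outerAction k A M N (1 ⊗ₜ MulOpposite.op a) z) : regularBimod k A ⟶ outerObj k A M N :=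
  ConcreteCategory.ofHom (C := ModuleCat (Env k A)) (X := regularBimod k A) (Y := outerObj k A M N)
    { toFun := fun x => outerMk M N (outerAction k A M N ((regularMk k A).symm x ⊗ₜ 1) z)
      map_add' := fun x y => by
        rw [map_add, TensorProduct.add_tmul, map_add, LinearMap.add_apply, map_add]
      map_smul' := fun r x => by
        change outerMk M N (outerAction k A M N ((regularMk k A).symm (r • x) ⊗ₜ 1) z) =
          outerMk M N (outerAction k A M N r
            (outerAction k A M N ((regularMk k A).symm x ⊗ₜ 1) z))
        congr 1
        induction r using TensorProduct.induction_on with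
        | zero =>
          refine (congrArg (fun y => outerAction k A M N ((regularMk k A).symm y ⊗ₜ 1) z)
            (zero_smul (Env k A) x)).trans ?_
          rw [map_zero, TensorProduct.zero_tmul, map_zero, LinearMap.zero_apply,
            LinearMap.zero_apply]
        | add r s hr hs =>
          rw [add_smul, map_add, TensorProduct.add_tmul, map_add, LinearMap.add_apply, hr, hs,
            map_add, LinearMap.add_apply]
        | tmul a b =>
          obtain ⟨x, rfl⟩ := (regularMk k A).surjective x
          rw [smul_regularMk, AddEquiv.symm_apply_apply, AddEquiv.symm_apply_apply,
            ← outerAction_mul_tmul, mul_one, ← mul_assoc]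
          -- The point is `(axb)z = (ax)(bz) = (ax)(zb)`; centrality moves `b` to the right of `z`.
          have h₁ := outerAction_mul_tmul (k := k) (a * x) b.unop (1 : Aᵐᵒᵖ) 1 z
          have h₂ := outerAction_mul_tmul (k := k) (a * x) (1 : A) (1 : Aᵐᵒᵖ) b z
          rw [hz, MulOpposite.op_unop, ← h₂, mul_one, one_mul, mul_one] at h₁
          rw [h₁] }

lemma homOfCentral_one (z : M ⊗[k] N) (hz : ∀ a : A, outerAction k A M N (a ⊗ₜ 1) z =
    outerAction k A M N (1 ⊗ₜ MulOpposite.op a) z) :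
    (homOfCentral z hz).hom (regularMk k A 1) = outerMk M N z := by
  change outerMk M N (outerAction k A M N (1 : Env k A) z) = _
  rw [map_one, Module.End.one_apply]

/-- In the bimodule `A` one has `a · 1 = 1 · a`, and a bimodule map preserves this equality. -/
lemma central_of_hom (f : regularBimod k A ⟶ outerObj k A M N) (a : A) :
    outerAction k A M N (a ⊗ₜ 1) ((outerMk M N).symm (f.hom (regularMk k A 1))) =
      outerAction k A M N (1 ⊗ₜ MulOpposite.op a)
        ((outerMk M N).symm (f.hom (regularMk k A 1))) := by
  apply (outerMk M N).injective
  rw [← smul_outerMk, ← smul_outerMk, LinearEquiv.apply_symm_apply, ← LinearMap.map_smul,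
    ← LinearMap.map_smul, smul_regularMk_one]

variable [Module.Finite k A]

lemma mem_ker_cotensorMap_iff (z : M ⊗[k] N) :
    cotensorMap ((toRComod k A).obj M) ((toLComod k A).obj N) z = 0 ↔
    ∀ a : A, outerAction k A M N (a ⊗ₜ 1) z = outerAction k A M N (1 ⊗ₜ MulOpposite.op a) z :=
  coact_eq_iff z

variable (M N) in
/-- `Hom_{A^e}(A, M ⊗ N) ≅ M □ N`. -/
def homEquivCotensor : (regularBimod k A ⟶ outerObj k A M N) ≃ₗ[k]
    LinearMap.ker (cotensorMap ((toRComod k A).obj M) ((toLComod k A).obj N)) where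
  toFun f := ⟨(outerMk M N).symm (f.hom (regularMk k A 1)),
    (mem_ker_cotensorMap_iff _).2 (central_of_hom f)⟩
  invFun z := homOfCentral (M := M) (N := N) z.1 ((mem_ker_cotensorMap_iff _).1 z.2)
  map_add' _ _ := Subtype.ext rfl
  map_smul' r f := Subtype.ext (map_smul (outerMk M N).symm r (f.hom (regularMk k A 1)))
  left_inv _ := regularBimod_hom_ext (homOfCentral_one (M := M) (N := N) _ _)
  right_inv z := Subtype.ext ((outerMk M N).symm_apply_eq.2
    (homOfCentral_one (M := M) (N := N) z.1 _))

/-- The functor `Hom_{A^e}(A, -)`. -/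
abbrev hochschildZero (k A : Type u) [Field k] [Ring A] [Algebra k A] :
    ModuleCat.{u} (Env k A) ⥤ ModuleCat.{u} k :=
  (linearCoyoneda k (ModuleCat.{u} (Env k A))).obj (Opposite.op (regularBimod k A))

variable (M N) in
/-- `M □ N ≅ Hom_{A^e}(A, M ⊗ N)`. -/
def cotensorIso : ((cotensor k (Dual k A)).obj ((toRComod k A).obj M)).obj ((toLComod k A).obj N) ≅
    (hochschildZero k A).obj (((outer k A).obj M).obj N) :=
  (homEquivCotensor (k := k) (A := A) M N).symm.toModuleIso

lemma cotensorIso_naturality (f : M ⟶ M') (g : N ⟶ N') :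
    ((cotensor k (Dual k A)).map ((toRComod k A).map f)).app ((toLComod k A).obj N) ≫
      ((cotensor k (Dual k A)).obj ((toRComod k A).obj M')).map ((toLComod k A).map g) ≫
      (cotensorIso M' N').hom =
    (cotensorIso M N).hom ≫ (hochschildZero k A).map
      (((outer k A).map f).app N ≫ ((outer k A).obj M').map g) := by
  rw [← Category.assoc]
  refine Iso.square_of_inv _ _ (ModuleCat.hom_ext (LinearMap.ext fun x => Subtype.ext ?_))
  rfl

end CotensorHom

/-! ### Injective modules as retracts of coinduced modules -/

section CoinducedRetraction

open scoped ModuleCat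

variable {k B : Type u} [Field k] [Ring B] [Algebra k B] {M : Type u} [AddCommGroup M] [Module k M]
  [Module B M] [IsScalarTower k B M]

variable (k B) in
/-- The map `b ↦ b m`. -/
def orbitMap (m : M) : B →ₗ[k] M := (LinearMap.toSpanSingleton B M m).restrictScalars k

@[simp]
lemma orbitMap_apply (m : M) (b : B) : orbitMap k B m b = b • m := rfl

variable (k B M) in
/-- The canonical map from `M` to the coinduced module `Hom_k(B, M)` has a `B`-linear
retraction. -/
def HasCoinducedRetraction : Prop :=
  ∃ ρ : (B →ₗ[k] M) →ₗ[k] M, (∀ b φ, ρ (φ ∘ₗ LinearMap.mulRight k b) = b • ρ φ) ∧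
    ∀ m, ρ (orbitMap k B m) = m

variable (k B M) in
/-- The coinduced module `Hom_k(B, M)`. -/
def Coinduced : Type u := B →ₗ[k] M

instance : AddCommGroup (Coinduced k B M) := inferInstanceAs (AddCommGroup (B →ₗ[k] M))

/-- Here `b` acts by precomposition with right multiplication and not through the values in `M`;
hence the separate type. -/
instance : Module B (Coinduced k B M) where
  smul b φ := φ.comp (LinearMap.mulRight k b)
  one_smul φ := by
    change φ.comp (LinearMap.mulRight k 1) = φ
    rw [LinearMap.mulRight_one]
    exact LinearMap.comp_id _
  mul_smul a b φ := by
    change φ.comp (LinearMap.mulRight k (a * b)) = _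
    rw [LinearMap.mulRight_mul]
    rfl
  smul_zero b := LinearMap.zero_comp _
  smul_add b φ ψ := LinearMap.add_comp _ _ _
  add_smul a b φ := LinearMap.ext fun x =>
    (congrArg (DFunLike.coe (F := B →ₗ[k] M) φ) (mul_add x a b)).trans
      (LinearMap.map_add (f := φ) _ _)
  zero_smul φ := LinearMap.ext fun x =>
    (congrArg (DFunLike.coe (F := B →ₗ[k] M) φ) (mul_zero x)).trans (LinearMap.map_zero (f := φ))

/-- The map `m ↦ (b ↦ b m)` is `B`-linear, and injective by evaluation at `1`. An injective module
splits off along it. -/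
lemma HasCoinducedRetraction.of_injective [Module.Injective B M] :
    HasCoinducedRetraction k B M := by
  let i : M →ₗ[B] Coinduced k B M :=
    { toFun := orbitMap k B
      map_add' := fun m m' => LinearMap.ext fun b => smul_add b m m'
      map_smul' := fun a m => LinearMap.ext fun b => (mul_smul b a m).symm }
  obtain ⟨h, hh⟩ := Module.Injective.out i (fun m m' hm => by
    rw [← one_smul B m, ← one_smul B m']
    exact LinearMap.congr_fun (hm : orbitMap k B m = orbitMap k B m') 1)
    (LinearMap.id : M →ₗ[B] M)
  let h' : (B →ₗ[k] M) → M := h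
  have hb (b : B) (φ : B →ₗ[k] M) : h' (φ ∘ₗ LinearMap.mulRight k b) = b • h' φ := h.map_smul b φ
  refine ⟨{ toFun := h', map_add' := h.map_add, map_smul' := fun r φ => ?_ }, hb, hh⟩
  -- The splitting is only known to be `B`-linear; it is `k`-linear because scalars act on the
  -- coinduced module through the centre of `B`.
  have : r • φ = φ ∘ₗ LinearMap.mulRight k (algebraMap k B r) := by
    ext b
    rw [LinearMap.comp_apply, LinearMap.mulRight_apply, ← Algebra.commutes, ← Algebra.smul_def,
      map_smul, LinearMap.smul_apply]
  rw [this, hb, algebraMap_smul, RingHom.id_apply]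

/-- Over the field `k` the inclusion `f` has a linear left inverse `p`. Then `y ↦ (b ↦ g (p (b y)))`
is a `B`-linear map into the coinduced module, and composing it with the retraction extends `g`. -/
lemma HasCoinducedRetraction.injective (hM : HasCoinducedRetraction k B M) :
    Module.Injective B M where
  out X Y _ _ _ _ f hf g := by
    obtain ⟨ρ, hρ, hρ'⟩ := hM
    let : Module k X := Module.compHom X (algebraMap k B)
    let : Module k Y := Module.compHom Y (algebraMap k B)
    have : IsScalarTower k B X := ⟨fun r b x => by
      rw [Algebra.smul_def, mul_smul]; rfl⟩
    have : IsScalarTower k B Y := ⟨fun r b x => by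
      rw [Algebra.smul_def, mul_smul]; rfl⟩
    obtain ⟨p, hp⟩ := (f.restrictScalars k).exists_leftInverse_of_injective
      (LinearMap.ker_eq_bot.2 hf)
    have hp (x : X) : p (f x) = x := LinearMap.congr_fun hp x
    let F : Y →ₗ[k] M := g.restrictScalars k ∘ₗ p
    refine ⟨{ toFun := fun y => ρ (F ∘ₗ orbitMap k B y), map_add' := fun y y' => ?_,
              map_smul' := fun b y => ?_ }, fun x => ?_⟩
    · rw [← map_add]
      congr 1
      ext b
      simp
    · rw [RingHom.id_apply, ← hρ]
      congr 1
      ext c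
      simp [mul_smul]
    · refine (congrArg ρ ?_).trans (hρ' (g x))
      ext b
      change g (p (b • f x)) = b • g x
      rw [← map_smul, hp, map_smul]

end CoinducedRetraction

/-! ### Injectivity of `M ⊗ N` over the enveloping algebra -/

section OuterInjective

open scoped ModuleCat

variable {k A : Type u} [Field k] [Ring A] [Algebra k A]
  {M N : Type u} [AddCommGroup M] [Module k M] [AddCommGroup N] [Module k N]
  [Module A M] [IsScalarTower k A M] [Module Aᵐᵒᵖ N] [IsScalarTower k Aᵐᵒᵖ N]

variable {P : Type u} [AddCommGroup P] [Module k P] [Module (Env k A) P]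
  [IsScalarTower k (Env k A) P] [Module.Finite k A]

/-- The retraction is `ρ ⊗ σ`, carried over by `Hom(A, M) ⊗ Hom(A^op, N) ≅ Hom(A^e, M ⊗ N)`, which
needs finite dimension. The equivalence `u` allows the bimodule `P` to be a separate copy of `M ⊗
N`. -/
lemma HasCoinducedRetraction.tensor (hM : HasCoinducedRetraction k A M)
    (hN : HasCoinducedRetraction k Aᵐᵒᵖ N) (u : M ⊗[k] N ≃ₗ[k] P)
    (hu : ∀ (r : Env k A) (z : M ⊗[k] N), r • u z = u (outerAction k A M N r z)) :
    HasCoinducedRetraction k (Env k A) P := by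
  obtain ⟨ρ, hρ, hρ'⟩ := hM
  obtain ⟨σ, hσ, hσ'⟩ := hN
  let e := homTensorHomEquiv k A Aᵐᵒᵖ M N ≪≫ₗ u.congrRight
  have he (φ : A →ₗ[k] M) (ψ : Aᵐᵒᵖ →ₗ[k] N) :
      e (φ ⊗ₜ ψ) = u.toLinearMap ∘ₗ TensorProduct.map φ ψ := by
    refine TensorProduct.ext' fun x y => ?_
    simp only [e, LinearEquiv.trans_apply, homTensorHomEquiv_apply]
    rfl
  refine ⟨u.toLinearMap ∘ₗ TensorProduct.map ρ σ ∘ₗ e.symm.toLinearMap, fun r Φ => ?_,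
    fun z => ?_⟩
  · obtain ⟨t, rfl⟩ := e.surjective Φ
    change u (TensorProduct.map ρ σ (e.symm (e t ∘ₗ LinearMap.mulRight k r))) =
      r • u (TensorProduct.map ρ σ (e.symm (e t)))
    rw [e.symm_apply_apply, hu]
    congr 1
    induction r using TensorProduct.induction_on with
    | zero => simp
    | add r s hr hs =>
      have : LinearMap.mulRight k (r + s) = LinearMap.mulRight k r + LinearMap.mulRight k s := by
        refine LinearMap.ext fun x => ?_
        simp [mul_add]
      rw [this, LinearMap.comp_add, map_add, map_add, hr, hs, map_add, LinearMap.add_apply]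
    | tmul a b =>
      induction t using TensorProduct.induction_on with
      | zero => simp
      | add t t' ht ht' =>
        rw [map_add, LinearMap.add_comp, map_add, map_add, ht, ht', map_add, map_add]
      | tmul φ ψ =>
        have : e (φ ⊗ₜ ψ) ∘ₗ LinearMap.mulRight k (a ⊗ₜ b) =
            e ((φ ∘ₗ LinearMap.mulRight k a) ⊗ₜ (ψ ∘ₗ LinearMap.mulRight k b)) := by
          rw [he, he]
          refine TensorProduct.ext' fun x y => ?_
          change u (TensorProduct.map φ ψ ((x ⊗ₜ y) * (a ⊗ₜ b))) = _
          rw [Algebra.TensorProduct.tmul_mul_tmul]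
          rfl
        rw [this, e.symm_apply_apply, TensorProduct.map_tmul, TensorProduct.map_tmul, hρ, hσ,
          outerAction_tmul]
  · obtain ⟨z, rfl⟩ := u.surjective z
    change u (TensorProduct.map ρ σ (e.symm (orbitMap k (Env k A) (u z)))) = u z
    congr 1
    induction z using TensorProduct.induction_on with
    | zero =>
      have : orbitMap k (Env k A) (u (0 : M ⊗[k] N)) = 0 := LinearMap.ext fun r => by simp
      rw [this, map_zero, map_zero]
    | add z z' hz hz' =>
      have : orbitMap k (Env k A) (u (z + z')) =
          orbitMap k (Env k A) (u z) + orbitMap k (Env k A) (u z') :=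
        LinearMap.ext fun r => by simp
      rw [this, map_add, map_add, hz, hz']
    | tmul m n =>
      -- On pure tensors the orbit map factors, so the identities for `ρ` and `σ` apply separately.
      have : orbitMap k (Env k A) (u (m ⊗ₜ n)) = e (orbitMap k A m ⊗ₜ orbitMap k Aᵐᵒᵖ n) := by
        rw [he]
        refine TensorProduct.ext' fun x y => ?_
        exact hu _ _
      rw [this, e.symm_apply_apply, TensorProduct.map_tmul, hρ', hσ']

variable (k) in
lemma injective_outerObj (M : ModuleCat.{u} A) (N : ModuleCat.{u} Aᵐᵒᵖ) [Injective M]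
    [Injective N] : Injective (outerObj k A M N) := by
  have := Module.injective_module_of_injective_object A M
  have := Module.injective_module_of_injective_object Aᵐᵒᵖ N
  have := (HasCoinducedRetraction.tensor (k := k) (A := A) (M := M) (N := N)
    .of_injective .of_injective (outerMk M N) smul_outerMk).injective
  exact Module.injective_object_of_injective_module (Env k A) (outerObj k A M N)

end OuterInjective

/-! ### Bifunctors on complexes: functoriality, homotopies, complexes in degree zero -/

namespace HomologicalComplex

section Functoriality

variable {C₁ C₂ D I₁ I₂ J : Type*} [Category* C₁] [Category* C₂] [Category* D]
  [Preadditive C₁] [Preadditive C₂] [Preadditive D]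
  {c₁ : ComplexShape I₁} {c₂ : ComplexShape I₂}
  {K₁ L₁ M₁ : HomologicalComplex C₁ c₁} {K₂ L₂ M₂ : HomologicalComplex C₂ c₂}
  (F : C₁ ⥤ C₂ ⥤ D) [F.PreservesZeroMorphisms] [∀ X, (F.obj X).PreservesZeroMorphisms]
  (c : ComplexShape J) [DecidableEq J] [TotalComplexShape c₁ c₂ c]
  [HasMapBifunctor K₁ K₂ F c] [HasMapBifunctor L₁ L₂ F c] [HasMapBifunctor M₁ M₂ F c]

lemma mapBifunctorMap_id : mapBifunctorMap (𝟙 K₁) (𝟙 K₂) F c = 𝟙 _ := by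
  refine HomologicalComplex.hom_ext _ _ fun j => mapBifunctor.hom_ext fun i₁ i₂ h => ?_
  rw [ι_mapBifunctorMap, id_f, id_f, id_f, F.map_id, (F.obj _).map_id, NatTrans.id_app,
    Category.id_comp, Category.id_comp, Category.comp_id]

lemma mapBifunctorMap_comp (f₁ : K₁ ⟶ L₁) (g₁ : L₁ ⟶ M₁) (f₂ : K₂ ⟶ L₂) (g₂ : L₂ ⟶ M₂) :
    mapBifunctorMap (f₁ ≫ g₁) (f₂ ≫ g₂) F c =
      mapBifunctorMap f₁ f₂ F c ≫ mapBifunctorMap g₁ g₂ F c := by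
  refine HomologicalComplex.hom_ext _ _ fun j => mapBifunctor.hom_ext fun i₁ i₂ h => ?_
  rw [comp_f, ι_mapBifunctorMap, ι_mapBifunctorMap_assoc, ι_mapBifunctorMap, comp_f, comp_f,
    F.map_comp, (F.obj _).map_comp, NatTrans.comp_app, Category.assoc, Category.assoc,
    ← NatTrans.naturality_assoc]

end Functoriality

section HomotopyEquiv

variable {C₁ C₂ D I₁ I₂ J : Type*} [Category* C₁] [Category* C₂] [Category* D]
  [Preadditive C₁] [Preadditive C₂] [Preadditive D]
  {c₁ : ComplexShape I₁} {c₂ : ComplexShape I₂}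
  {K₁ L₁ : HomologicalComplex C₁ c₁} {K₂ L₂ : HomologicalComplex C₂ c₂}
  (F : C₁ ⥤ C₂ ⥤ D) [F.Additive] [∀ X, (F.obj X).Additive]
  (c : ComplexShape J) [DecidableEq J] [TotalComplexShape c₁ c₂ c]
  [HasMapBifunctor K₁ K₂ F c] [HasMapBifunctor L₁ L₂ F c]

variable {F} in
/-- Self-maps homotopic to the identity induce a self-map homotopic to the identity. -/
def mapBifunctorMapHomotopyId {f₁ : K₁ ⟶ K₁} {f₂ : K₂ ⟶ K₂} (h₁ : Homotopy f₁ (𝟙 K₁))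
    (h₂ : Homotopy f₂ (𝟙 K₂)) : Homotopy (mapBifunctorMap f₁ f₂ F c) (𝟙 _) :=
  ((mapBifunctorMapHomotopy₁ h₁ f₂ F c).trans (mapBifunctorMapHomotopy₂ (𝟙 K₁) h₂ F c)).trans
    (Homotopy.ofEq (mapBifunctorMap_id F c))

/-- Homotopy equivalences induce a homotopy equivalence on total complexes. -/
@[simps hom]
def mapBifunctorHomotopyEquiv (e₁ : HomotopyEquiv K₁ L₁) (e₂ : HomotopyEquiv K₂ L₂) :
    HomotopyEquiv (mapBifunctor K₁ K₂ F c) (mapBifunctor L₁ L₂ F c) where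
  hom := mapBifunctorMap e₁.hom e₂.hom F c
  inv := mapBifunctorMap e₁.inv e₂.inv F c
  homotopyHomInvId := (Homotopy.ofEq (mapBifunctorMap_comp F c _ _ _ _).symm).trans
    (mapBifunctorMapHomotopyId c e₁.homotopyHomInvId e₂.homotopyHomInvId)
  homotopyInvHomId := (Homotopy.ofEq (mapBifunctorMap_comp F c _ _ _ _).symm).trans
    (mapBifunctorMapHomotopyId c e₁.homotopyInvHomId e₂.homotopyInvHomId)

end HomotopyEquiv

end HomologicalComplex

namespace HomologicalComplex

section Nat

variable {C₁ C₂ D : Type*} [Category* C₁] [Category* C₂] [Category* D]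
  [Preadditive C₁] [Preadditive C₂] [Preadditive D] [HasFiniteCoproducts D]

instance hasMapBifunctor_up (F : C₁ ⥤ C₂ ⥤ D) [F.PreservesZeroMorphisms]
    [∀ X, (F.obj X).PreservesZeroMorphisms] (K₁ : CochainComplex C₁ ℕ) (K₂ : CochainComplex C₂ ℕ) :
    HasMapBifunctor K₁ K₂ F (ComplexShape.up ℕ) := fun _ => inferInstance

/-- Each degree is a finite coproduct of injectives, hence a biproduct, hence also a product. -/
lemma injective_mapBifunctor_X (F : C₁ ⥤ C₂ ⥤ D) [F.PreservesZeroMorphisms]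
    [∀ X, (F.obj X).PreservesZeroMorphisms] (K₁ : CochainComplex C₁ ℕ) (K₂ : CochainComplex C₂ ℕ)
    [∀ i j, Injective ((F.obj (K₁.X i)).obj (K₂.X j))] (n : ℕ) :
    Injective ((mapBifunctor K₁ K₂ F (ComplexShape.up ℕ)).X n) := by
  have := HasFiniteBiproducts.of_hasFiniteCoproducts (C := D)
  let f (i : ComplexShape.π (ComplexShape.up ℕ) (ComplexShape.up ℕ) (ComplexShape.up ℕ) ⁻¹' {n}) :
    D := (F.obj (K₁.X i.1.1)).obj (K₂.X i.1.2)
  exact Injective.of_iso (biproduct.isoCoproduct f) inferInstance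

variable [HasZeroObject C₁] [HasZeroObject C₂] [HasZeroObject D]
  (F : C₁ ⥤ C₂ ⥤ D) [F.PreservesZeroMorphisms] [∀ X, (F.obj X).PreservesZeroMorphisms]

/-- In `ℕ` the only bidegree of total degree `0` is `(0, 0)`. -/
instance isIso_ιMapBifunctor_zero (K₁ : CochainComplex C₁ ℕ) (K₂ : CochainComplex C₂ ℕ) :
    IsIso (ιMapBifunctor K₁ K₂ F (ComplexShape.up ℕ) 0 0 0 rfl) := by
  refine ⟨mapBifunctorDesc fun i₁ i₂ (h : i₁ + i₂ = 0) => eqToHom ?_, ?_,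
    mapBifunctor.hom_ext fun i₁ i₂ (h : i₁ + i₂ = 0) => ?_⟩
  · obtain ⟨rfl, rfl⟩ := Nat.add_eq_zero_iff.1 h
    rfl
  · rw [ι_mapBifunctorDesc, eqToHom_refl]
  · obtain ⟨rfl, rfl⟩ := Nat.add_eq_zero_iff.1 h
    rw [ι_mapBifunctorDesc_assoc, eqToHom_refl, Category.id_comp, Category.comp_id]

variable {X₁ Y₁ : C₁} {X₂ Y₂ : C₂}

variable (X₁ X₂) in
lemma isZero_mapBifunctor_single (n : ℕ) (hn : n ≠ 0) :
    IsZero ((mapBifunctor ((CochainComplex.single₀ C₁).obj X₁) ((CochainComplex.single₀ C₂).obj X₂)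
      F (ComplexShape.up ℕ)).X n) := by
  rw [IsZero.iff_id_eq_zero]
  refine mapBifunctor.hom_ext fun i₁ i₂ (h : i₁ + i₂ = n) => IsZero.eq_of_src ?_ _ _
  by_cases h₁ : i₁ = 0
  · exact (F.obj _).map_isZero (isZero_single_obj_X _ _ _ _ (by lia))
  · exact ((F.map_isZero (isZero_single_obj_X _ _ _ _ h₁)).obj _)

variable (X₁ X₂) in
/-- The comparison between a bifunctor on objects and on complexes concentrated in degree `0`. -/
def mapBifunctorSingle : (CochainComplex.single₀ D).obj ((F.obj X₁).obj X₂) ⟶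
    mapBifunctor ((CochainComplex.single₀ C₁).obj X₁) ((CochainComplex.single₀ C₂).obj X₂) F
      (ComplexShape.up ℕ) :=
  (CochainComplex.fromSingle₀Equiv _ _).symm
    ⟨ιMapBifunctor ((CochainComplex.single₀ C₁).obj X₁) ((CochainComplex.single₀ C₂).obj X₂) F
      (ComplexShape.up ℕ) 0 0 0 rfl,
      (isZero_mapBifunctor_single F X₁ X₂ 1 one_ne_zero).eq_of_tgt _ _⟩

lemma mapBifunctorSingle_f_zero : (mapBifunctorSingle F X₁ X₂).f 0 =
    ιMapBifunctor ((CochainComplex.single₀ C₁).obj X₁) ((CochainComplex.single₀ C₂).obj X₂) F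
      (ComplexShape.up ℕ) 0 0 0 rfl := by
  exact CochainComplex.fromSingle₀Equiv_symm_apply_f_zero _ _

instance : IsIso (mapBifunctorSingle F X₁ X₂) :=
  have (n : ℕ) : IsIso ((mapBifunctorSingle F X₁ X₂).f n) := by
    obtain - | n := n
    · rw [mapBifunctorSingle_f_zero]
      exact isIso_ιMapBifunctor_zero F _ _
    · exact (isZero_single_obj_X _ _ _ _ n.succ_ne_zero).isIso
        (isZero_mapBifunctor_single F X₁ X₂ _ n.succ_ne_zero) _
  Hom.isIso_of_components _

end Nat

end HomologicalComplex

namespace HomologicalComplex.BifunctorComparison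

variable {C₁ C₂ D₁ D₂ D E I₁ I₂ : Type*} [Category* C₁] [Category* C₂] [Category* D₁]
  [Category* D₂] [Category* D] [Category* E] [Preadditive C₁] [Preadditive C₂]
  [Preadditive D₁] [Preadditive D₂] [Preadditive D] [Preadditive E]
  {c₁ : ComplexShape I₁} {c₂ : ComplexShape I₂}
  {T : C₁ ⥤ C₂ ⥤ E} {G : D₁ ⥤ D₂ ⥤ D} {F : D ⥤ E} {F₁ : D₁ ⥤ C₁} {F₂ : D₂ ⥤ C₂}
  [F₁.PreservesZeroMorphisms] [F₂.PreservesZeroMorphisms]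

/-- The comparison given by a natural isomorphism `T(F₁ X, F₂ Y) ≅ F(G(X, Y))`. -/
@[simps iso]
def ofNatural (τ : ∀ X Y, (T.obj (F₁.obj X)).obj (F₂.obj Y) ≅ F.obj ((G.obj X).obj Y))
    (hτ : ∀ {X X' : D₁} {Y Y' : D₂} (f : X ⟶ X') (g : Y ⟶ Y'),
      (T.map (F₁.map f)).app (F₂.obj Y) ≫ (T.obj (F₁.obj X')).map (F₂.map g) ≫ (τ X' Y').hom =
        (τ X Y).hom ≫ F.map ((G.map f).app Y ≫ (G.obj X').map g))
    (L₁ : HomologicalComplex D₁ c₁) (L₂ : HomologicalComplex D₂ c₂) :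
    BifunctorComparison T G F ((F₁.mapHomologicalComplex c₁).obj L₁)
      ((F₂.mapHomologicalComplex c₂).obj L₂) L₁ L₂ where
  iso i₁ i₂ := τ (L₁.X i₁) (L₂.X i₂)
  comm₁ i₁ i₁' i₂ := by
    have := hτ (L₁.d i₁ i₁') (𝟙 (L₂.X i₂))
    rw [F₂.map_id, CategoryTheory.Functor.map_id, CategoryTheory.Functor.map_id,
      Category.id_comp, Category.comp_id] at this
    exact this
  comm₂ i₁ i₂ i₂' := by
    have := hτ (𝟙 (L₁.X i₁)) (L₂.d i₂ i₂')
    rw [F₁.map_id, CategoryTheory.Functor.map_id, CategoryTheory.Functor.map_id,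
      NatTrans.id_app, NatTrans.id_app, Category.id_comp, Category.id_comp] at this
    exact this

end HomologicalComplex.BifunctorComparison

/-- When `F.obj X` is injective it is its own resolution, concentrated in degree `0`. The image of
`I` is a second injective resolution, and the two are homotopy equivalent, by a map that can be
taken to be the augmentation itself. -/
lemma CategoryTheory.InjectiveResolution.exists_homotopyEquiv_map_ι {𝒟 𝒞 : Type*} [Category* 𝒟]
    [Category* 𝒞] [Abelian 𝒟] [Abelian 𝒞] {X : 𝒟} (I : InjectiveResolution X) (F : 𝒟 ⥤ 𝒞)
    [F.Additive] [F.PreservesHomology] [Injective (F.obj X)]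
    (hI : ∀ n, Injective (F.obj (I.cocomplex.X n))) :
    ∃ e : HomotopyEquiv ((F.mapHomologicalComplex _).obj ((CochainComplex.single₀ 𝒟).obj X))
      ((F.mapHomologicalComplex _).obj I.cocomplex),
      e.hom = (F.mapHomologicalComplex _).map I.ι := by
  let s := (HomologicalComplex.singleMapHomologicalComplex F (ComplexShape.up ℕ) 0).app X
  let e := homotopyEquiv (self (F.obj X)) (I.mapOfInjective F hI)
  have he : e.hom = s.inv ≫ (F.mapHomologicalComplex _).map I.ι :=
    (Category.id_comp _).symm.trans (homotopyEquiv_hom_ι (self (F.obj X)) (I.mapOfInjective F hI))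
  refine ⟨(HomotopyEquiv.ofIso s).trans e, ?_⟩
  exact (congrArg (s.hom ≫ ·) he).trans (s.hom_inv_id_assoc _)

/-! ### The injective resolution of the bimodule `M ⊗ N` -/

section OuterResolution

open HomologicalComplex

open scoped ModuleCat

variable (k : Type u) {A : Type u} [Field k] [Ring A] [Algebra k A]

/-- The underlying vector space of a module. -/
abbrev forgetToField (B : Type u) [Ring B] [Algebra k B] : ModuleCat.{u} B ⥤ ModuleCat.{u} k :=
  ModuleCat.restrictScalars (algebraMap k B)

lemma injective_moduleCat_field (V : ModuleCat.{u} k) : Injective V := by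
  have : HasCoinducedRetraction k k V :=
    -- For `B = k` the coinduced module is `V` itself, through evaluation at `1`.
    ⟨LinearMap.applyₗ 1, fun b φ => by simpa using φ.map_smul b 1, fun m => by simp⟩
  have := this.injective
  exact Module.injective_object_of_injective_module k V

instance (B : Type u) [Ring B] [Algebra k B] : (forgetToField k B).PreservesHomology :=
  Functor.preservesHomology_of_map_exact _ fun S hS => by
    rw [ShortComplex.ShortExact.moduleCat_exact_iff_function_exact] at hS ⊢
    exact hS

variable {k}

variable (k) in
/-- The underlying vector space of the bimodule `M ⊗ N`. -/
def forgetOuterIso (M : ModuleCat.{u} A) (N : ModuleCat.{u} Aᵐᵒᵖ) :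
    ((MonoidalCategory.curriedTensor (ModuleCat.{u} k)).obj ((forgetToField k A).obj M)).obj
      ((forgetToField k Aᵐᵒᵖ).obj N) ≅
    (forgetToField k (Env k A)).obj (((outer k A).obj M).obj N) :=
  LinearEquiv.toModuleIso (X₁ := (forgetToField k A).obj M ⊗[k] (forgetToField k Aᵐᵒᵖ).obj N)
    (X₂ := (forgetToField k (Env k A)).obj (outerObj k A M N))
    (outerMk (k := k) M N)

lemma forgetOuterIso_naturality {M M' : ModuleCat.{u} A} {N N' : ModuleCat.{u} Aᵐᵒᵖ}
    (f : M ⟶ M') (g : N ⟶ N') :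
    ((MonoidalCategory.curriedTensor (ModuleCat.{u} k)).map ((forgetToField k A).map f)).app
        ((forgetToField k Aᵐᵒᵖ).obj N) ≫
      ((MonoidalCategory.curriedTensor (ModuleCat.{u} k)).obj ((forgetToField k A).obj M')).map
        ((forgetToField k Aᵐᵒᵖ).map g) ≫ (forgetOuterIso k M' N').hom =
    (forgetOuterIso k M N).hom ≫ (forgetToField k (Env k A)).map
      (((outer k A).map f).app N ≫ ((outer k A).obj M').map g) :=
  ModuleCat.hom_ext (TensorProduct.ext' fun _ _ => rfl)

/-- The underlying complex of the total complex of `L₁ ⊗ L₂`. -/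
def forgetOuterComparison (L₁ : CochainComplex (ModuleCat.{u} A) ℕ)
    (L₂ : CochainComplex (ModuleCat.{u} Aᵐᵒᵖ) ℕ) :
    BifunctorComparison (MonoidalCategory.curriedTensor (ModuleCat.{u} k)) (outer k A)
      (forgetToField k (Env k A)) (((forgetToField k A).mapHomologicalComplex _).obj L₁)
      (((forgetToField k Aᵐᵒᵖ).mapHomologicalComplex _).obj L₂) L₁ L₂ :=
  .ofNatural (forgetOuterIso k) forgetOuterIso_naturality L₁ L₂

variable {M : ModuleCat.{u} A} {N : ModuleCat.{u} Aᵐᵒᵖ}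

/-- Quasi-isomorphisms can be tested on underlying vector spaces. There the augmentations of `P` and
`Q` become homotopy equivalences, since all vector spaces are injective, and so does their tensor
product. No Künneth formula or spectral sequence is needed. -/
instance quasiIso_mapBifunctorMap_outer (P : InjectiveResolution M) (Q : InjectiveResolution N) :
    QuasiIso (mapBifunctorMap P.ι Q.ι (outer k A) (ComplexShape.up ℕ)) := by
  have (V : ModuleCat.{u} k) : Injective V := injective_moduleCat_field k V
  rw [← quasiIso_map_iff_of_preservesHomology _ (forgetToField k (Env k A))]
  obtain ⟨e₁, he₁⟩ := P.exists_homotopyEquiv_map_ι (forgetToField k A) inferInstance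
  obtain ⟨e₂, he₂⟩ := Q.exists_homotopyEquiv_map_ι (forgetToField k Aᵐᵒᵖ) inferInstance
  have h := (forgetOuterComparison (k := k) _ _).hom_naturality (ComplexShape.up ℕ)
    (forgetOuterComparison _ _) e₁.hom e₂.hom P.ι Q.ι fun i₁ i₂ => by
      rw [he₁, he₂]
      exact forgetOuterIso_naturality _ _
  have : QuasiIso (mapBifunctorMap e₁.hom e₂.hom (MonoidalCategory.curriedTensor (ModuleCat.{u} k))
    (ComplexShape.up ℕ)) := (mapBifunctorHomotopyEquiv _ (ComplexShape.up ℕ) e₁ e₂).quasiIso_hom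
  have : QuasiIso ((forgetOuterComparison (k := k) _ _).hom (ComplexShape.up ℕ) ≫
      ((forgetToField k (Env k A)).mapHomologicalComplex _).map
        (mapBifunctorMap P.ι Q.ι (outer k A) (ComplexShape.up ℕ))) := by
    rw [← h]
    exact quasiIso_comp _ _
  exact quasiIso_of_comp_left ((forgetOuterComparison (k := k) _ _).hom (ComplexShape.up ℕ)) _

lemma outer_map_app_comp_map {M M' : ModuleCat.{u} A} {N N' : ModuleCat.{u} Aᵐᵒᵖ}
    (f : M ⟶ M') (g : N ⟶ N') :
    ((outer k A).map f).app N ≫ ((outer k A).obj M').map g = outerMap k A f g :=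
  outerObj_hom_ext fun _ _ => rfl

variable [Module.Finite k A]

variable (k) in
/-- The injective resolution of the bimodule `M ⊗ N` given by injective resolutions of `M` and
`N`. -/
def outerResolution (P : InjectiveResolution M) (Q : InjectiveResolution N) :
    InjectiveResolution (outerObj k A M N) where
  cocomplex := mapBifunctor P.cocomplex Q.cocomplex (outer k A) (ComplexShape.up ℕ)
  injective :=
    have (i j : ℕ) : Injective (((outer k A).obj (P.cocomplex.X i)).obj (Q.cocomplex.X j)) :=
      injective_outerObj k _ _
    injective_mapBifunctor_X _ _ _
  ι := mapBifunctorSingle (outer k A) M N ≫ mapBifunctorMap P.ι Q.ι _ _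
  quasiIso :=
    have : IsIso (mapBifunctorSingle (outer k A) M N) := inferInstance
    have : QuasiIso (mapBifunctorSingle (outer k A) M N ≫
      mapBifunctorMap P.ι Q.ι _ (ComplexShape.up ℕ)) := inferInstance
    this

/-- A map of resolutions lifts a given map as soon as it does so in degree `0`; this describes the
augmentation there. -/
lemma outerResolution_ι_f_zero (P : InjectiveResolution M) (Q : InjectiveResolution N) :
    (outerResolution k P Q).ι.f 0 = outerMap k A (P.ι.f 0) (Q.ι.f 0) ≫
      ιMapBifunctor P.cocomplex Q.cocomplex (outer k A) (ComplexShape.up ℕ) 0 0 0 rfl := by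
  change (mapBifunctorSingle (outer k A) M N).f 0 ≫
    (mapBifunctorMap P.ι Q.ι (outer k A) (ComplexShape.up ℕ)).f 0 = _
  refine (congrArg (· ≫ _) (mapBifunctorSingle_f_zero (outer k A))).trans ?_
  refine (ι_mapBifunctorMap _ _ _ _ 0 0 0 rfl).trans ?_
  rw [← Category.assoc, outer_map_app_comp_map]
  rfl

/-- The cochain map induced by lifts of `f` and `g` lifts `f ⊗ g`. -/
def outerResolutionHom {M' : ModuleCat.{u} A} {N' : ModuleCat.{u} Aᵐᵒᵖ} {f : M ⟶ M'} {g : N ⟶ N'}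
    {P : InjectiveResolution M} {Q : InjectiveResolution N}
    {P' : InjectiveResolution M'} {Q' : InjectiveResolution N'}
    {φ : P.cocomplex ⟶ P'.cocomplex} {ψ : Q.cocomplex ⟶ Q'.cocomplex}
    (hφ : IsLiftOf φ f) (hψ : IsLiftOf ψ g) :
    (outerResolution k P Q).Hom (outerResolution k P' Q') (outerMap k A f g) where
  hom := mapBifunctorMap φ ψ (outer k A) (ComplexShape.up ℕ)
  ι_f_zero_comp_hom_f_zero := by
    have h₁ : P.ι.f 0 ≫ φ.f 0 = f ≫ P'.ι.f 0 := HomologicalComplex.congr_hom hφ 0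
    have h₂ : Q.ι.f 0 ≫ ψ.f 0 = g ≫ Q'.ι.f 0 := HomologicalComplex.congr_hom hψ 0
    have key : outerMap k A (P.ι.f 0) (Q.ι.f 0) ≫ outerMap k A (φ.f 0) (ψ.f 0) =
        outerMap k A f g ≫ outerMap k A (P'.ι.f 0) (Q'.ι.f 0) :=
      (outerMap_comp _ _ _ _).trans ((congrArg₂ (outerMap k A) h₁ h₂).trans
        (outerMap_comp _ _ _ _).symm)
    let i := ιMapBifunctor P'.cocomplex Q'.cocomplex (outer k A) (ComplexShape.up ℕ) 0 0 0 rfl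
    have hi : ιMapBifunctor P.cocomplex Q.cocomplex (outer k A) (ComplexShape.up ℕ) 0 0 0 rfl ≫
        (mapBifunctorMap φ ψ (outer k A) (ComplexShape.up ℕ)).f 0 =
          outerMap k A (φ.f 0) (ψ.f 0) ≫ i := by
      rw [ι_mapBifunctorMap, ← Category.assoc, outer_map_app_comp_map]
      rfl
    refine (congrArg (· ≫ _) (outerResolution_ι_f_zero P Q)).trans ?_
    refine Eq.trans ?_ (congrArg (_ ≫ ·) (outerResolution_ι_f_zero P' Q')).symm
    refine (Category.assoc _ _ _).trans ((congrArg (_ ≫ ·) hi).trans ?_)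
    refine (Category.assoc _ _ _).symm.trans ((congrArg (· ≫ i) key).trans (Category.assoc _ _ _))

end OuterResolution

namespace HomologicalComplex

variable {C₁ C₂ D I₁ I₂ J : Type*} [Category* C₁] [Category* C₂] [Category* D]
  [Preadditive C₁] [Preadditive C₂] [Preadditive D]
  {c₁ : ComplexShape I₁} {c₂ : ComplexShape I₂}
  {K₁ L₁ : HomologicalComplex C₁ c₁} {K₂ L₂ : HomologicalComplex C₂ c₂}
  (F : C₁ ⥤ C₂ ⥤ D) [F.PreservesZeroMorphisms] [∀ X, (F.obj X).PreservesZeroMorphisms]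
  (c : ComplexShape J) [DecidableEq J] [TotalComplexShape c₁ c₂ c]
  [HasMapBifunctor K₁ K₂ F c] [HasMapBifunctor L₁ L₂ F c]

/-- Isomorphisms of complexes induce an isomorphism on total complexes. -/
@[simps]
def mapBifunctorMapIso (e₁ : K₁ ≅ L₁) (e₂ : K₂ ≅ L₂) :
    mapBifunctor K₁ K₂ F c ≅ mapBifunctor L₁ L₂ F c where
  hom := mapBifunctorMap e₁.hom e₂.hom F c
  inv := mapBifunctorMap e₁.inv e₂.inv F c
  hom_inv_id := by
    rw [← mapBifunctorMap_comp, e₁.hom_inv_id, e₂.hom_inv_id, mapBifunctorMap_id]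
  inv_hom_id := by
    rw [← mapBifunctorMap_comp, e₁.inv_hom_id, e₂.inv_hom_id, mapBifunctorMap_id]

end HomologicalComplex

/-! ### Total complexes transported along equivalences -/

section Counit

variable {𝒟 𝒞 I : Type*} [Category* 𝒟] [Category* 𝒞] [Preadditive 𝒟] [Preadditive 𝒞]
  (F : 𝒟 ⥤ 𝒞) [F.Additive] [F.IsEquivalence] {c : ComplexShape I}

/-- A complex is isomorphic to the image of its image under the inverse of an equivalence. -/
def counitComplexIso (K : HomologicalComplex 𝒞 c) :
    K ≅ (F.mapHomologicalComplex c).obj ((F.inv.mapHomologicalComplex c).obj K) :=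
  HomologicalComplex.Hom.isoOfComponents (fun i => (F.asEquivalence.counitIso.app (K.X i)).symm)
    fun i j _ => (F.asEquivalence.counitInv.naturality (K.d i j)).symm

lemma counitComplexIso_naturality {K K' : HomologicalComplex 𝒞 c} (φ : K ⟶ K') :
    φ ≫ (counitComplexIso F K').hom = (counitComplexIso F K).hom ≫
      (F.mapHomologicalComplex c).map ((F.inv.mapHomologicalComplex c).map φ) :=
  HomologicalComplex.hom_ext _ _ fun i => F.asEquivalence.counitInv.naturality (φ.f i)

end Counit

namespace HomologicalComplex

variable {C₁ C₂ D₁ D₂ D E I₁ I₂ J : Type*} [Category* C₁] [Category* C₂] [Category* D₁]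
  [Category* D₂] [Category* D] [Category* E] [Preadditive C₁] [Preadditive C₂]
  [Preadditive D₁] [Preadditive D₂] [Preadditive D] [Preadditive E]
  {c₁ : ComplexShape I₁} {c₂ : ComplexShape I₂}
  {T : C₁ ⥤ C₂ ⥤ E} [T.PreservesZeroMorphisms] [∀ X, (T.obj X).PreservesZeroMorphisms]
  {G : D₁ ⥤ D₂ ⥤ D} [G.PreservesZeroMorphisms] [∀ X, (G.obj X).PreservesZeroMorphisms]
  {F : D ⥤ E} [F.Additive] {F₁ : D₁ ⥤ C₁} {F₂ : D₂ ⥤ C₂}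
  [F₁.Additive] [F₂.Additive] [F₁.IsEquivalence] [F₂.IsEquivalence]
  (c : ComplexShape J) [DecidableEq J] [TotalComplexShape c₁ c₂ c]
  [∀ j, Finite (ComplexShape.π c₁ c₂ c ⁻¹' {j})] [HasFiniteCoproducts D] [HasFiniteCoproducts E]
  (τ : ∀ X Y, (T.obj (F₁.obj X)).obj (F₂.obj Y) ≅ F.obj ((G.obj X).obj Y))
  (hτ : ∀ {X X' : D₁} {Y Y' : D₂} (f : X ⟶ X') (g : Y ⟶ Y'),
    (T.map (F₁.map f)).app (F₂.obj Y) ≫ (T.obj (F₁.obj X')).map (F₂.map g) ≫ (τ X' Y').hom =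
      (τ X Y).hom ≫ F.map ((G.map f).app Y ≫ (G.obj X').map g))
  (K₁ K₁' : HomologicalComplex C₁ c₁) (K₂ K₂' : HomologicalComplex C₂ c₂)

/-- A natural isomorphism `T(F₁ X, F₂ Y) ≅ F(G(X, Y))`, for equivalences `F₁` and `F₂`, describes
the total complex of `T(K₁, K₂)`. -/
def totalIsoOfNatural : mapBifunctor K₁ K₂ T c ≅ (F.mapHomologicalComplex c).obj
    (mapBifunctor ((F₁.inv.mapHomologicalComplex c₁).obj K₁)
      ((F₂.inv.mapHomologicalComplex c₂).obj K₂) G c) :=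
  mapBifunctorMapIso T c (counitComplexIso F₁ K₁) (counitComplexIso F₂ K₂) ≪≫
    asIso ((BifunctorComparison.ofNatural τ hτ _ _).hom c)

variable {K₁ K₁' K₂ K₂'}

/-- The counit square commutes by naturality, and the comparison square can be checked in each
bidegree, where it is `hτ`. -/
lemma totalIsoOfNatural_naturality (φ : K₁ ⟶ K₁') (ψ : K₂ ⟶ K₂') :
    mapBifunctorMap φ ψ T c ≫ (totalIsoOfNatural c τ hτ K₁' K₂').hom =
      (totalIsoOfNatural c τ hτ K₁ K₂).hom ≫ (F.mapHomologicalComplex c).map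
        (mapBifunctorMap ((F₁.inv.mapHomologicalComplex c₁).map φ)
          ((F₂.inv.mapHomologicalComplex c₂).map ψ) G c) := by
  rw [totalIsoOfNatural, totalIsoOfNatural, Iso.trans_hom, Iso.trans_hom, asIso_hom, asIso_hom,
    mapBifunctorMapIso_hom, mapBifunctorMapIso_hom, ← Category.assoc, ← mapBifunctorMap_comp,
    counitComplexIso_naturality, counitComplexIso_naturality, mapBifunctorMap_comp, Category.assoc,
    Category.assoc]
  congr 1
  exact (BifunctorComparison.ofNatural τ hτ _ _).hom_naturality c
    (BifunctorComparison.ofNatural τ hτ _ _) _ _ _ _ fun _ _ => hτ _ _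

end HomologicalComplex

/-! ### Cotor as Hochschild cohomology -/

section Comparison

open HomologicalComplex Module

variable {k A : Type u} [Field k] [Ring A] [Algebra k A] [Module.Finite k A]

/-- The total complex of `K₁ □ K₂` as a complex of bimodule maps. -/
def cotensorComplexIso (K₁ : CochainComplex (RComod k (Dual k A)) ℕ)
    (K₂ : CochainComplex (LComod k (Dual k A)) ℕ) :
    cotensorComplex K₁ K₂ ≅ ((hochschildZero k A).mapHomologicalComplex _).obj
      (mapBifunctor (((toRComod k A).inv.mapHomologicalComplex _).obj K₁)
        (((toLComod k A).inv.mapHomologicalComplex _).obj K₂) (outer k A) (ComplexShape.up ℕ)) :=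
  totalIsoOfNatural (T := cotensor k (Dual k A)) (G := outer k A) (F := hochschildZero k A)
    (F₁ := toRComod k A) (F₂ := toLComod k A) (ComplexShape.up ℕ) (fun X Y => cotensorIso X Y)
    (fun f g => cotensorIso_naturality f g) K₁ K₂

lemma cotensorComplexIso_naturality {K₁ K₁' : CochainComplex (RComod k (Dual k A)) ℕ}
    {K₂ K₂' : CochainComplex (LComod k (Dual k A)) ℕ} (φ : K₁ ⟶ K₁') (ψ : K₂ ⟶ K₂') :
    mapBifunctorMap φ ψ (cotensor k (Dual k A)) (ComplexShape.up ℕ) ≫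
      (cotensorComplexIso K₁' K₂').hom =
    (cotensorComplexIso K₁ K₂).hom ≫ ((hochschildZero k A).mapHomologicalComplex _).map
      (mapBifunctorMap (((toRComod k A).inv.mapHomologicalComplex _).map φ)
        (((toLComod k A).inv.mapHomologicalComplex _).map ψ) (outer k A) (ComplexShape.up ℕ)) :=
  totalIsoOfNatural_naturality (T := cotensor k (Dual k A)) (G := outer k A)
    (F := hochschildZero k A) (F₁ := toRComod k A) (F₂ := toLComod k A) (ComplexShape.up ℕ)
    (fun X Y => cotensorIso X Y) (fun f g => cotensorIso_naturality f g) φ ψ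

variable {M M' : ModuleCat.{u} A} {N N' : ModuleCat.{u} Aᵐᵒᵖ}

/-- `Cotor^n(M, N)` is the Hochschild cohomology of `A` with coefficients in `M ⊗ N`. -/
def cotorEquivHochschild (I : InjectiveResolution ((toRComod k A).obj M))
    (J : InjectiveResolution ((toLComod k A).obj N)) (n : ℕ) :
    cotor I J n ≃ₗ[k] Hochschild k (outerObj k A M N) n :=
  (homologyMapIso (cotensorComplexIso I.cocomplex J.cocomplex) n).toLinearEquiv ≪≫ₗ
    (outerResolution k (I.ofEquivalence (toRComod k A))
      (J.ofEquivalence (toLComod k A))).homologyEquivExt (regularBimod k A) k n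

/-- Two squares are pasted: naturality of the identification of complexes, and naturality of `Ext`.
The second applies because the lifts, transported to modules and tensored, lift `f ⊗ g`. -/
lemma cotorEquivHochschild_naturality (f : M ⟶ M') (g : N ⟶ N')
    {I : InjectiveResolution ((toRComod k A).obj M)}
    {I' : InjectiveResolution ((toRComod k A).obj M')}
    {J : InjectiveResolution ((toLComod k A).obj N)}
    {J' : InjectiveResolution ((toLComod k A).obj N')}
    {φ : I.cocomplex ⟶ I'.cocomplex} {ψ : J.cocomplex ⟶ J'.cocomplex}
    (hφ : IsLiftOf φ ((toRComod k A).map f)) (hψ : IsLiftOf ψ ((toLComod k A).map g))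
    (n : ℕ) (x : cotor I J n) :
    cotorEquivHochschild I' J' n ((cotorMap φ ψ n).hom x) =
      hochschildMap k (outerMap k A f g) n (cotorEquivHochschild I J n x) := by
  have h := congrArg (fun φ => homologyMap φ n) (cotensorComplexIso_naturality φ ψ)
  rw [homologyMap_comp, homologyMap_comp] at h
  refine (congrArg ((outerResolution k (I'.ofEquivalence (toRComod k A))
    (J'.ofEquivalence (toLComod k A))).homologyEquivExt (regularBimod k A) k n)
    (LinearMap.congr_fun (ModuleCat.hom_ext_iff.1 h) x)).trans ?_
  exact InjectiveResolution.homologyEquivExt_naturality (regularBimod k A)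
    (outerResolution k (I.ofEquivalence (toRComod k A)) (J.ofEquivalence (toLComod k A))) k n
    (outerResolutionHom (InjectiveResolution.isLiftOf_ofEquivalence (toRComod k A) f hφ)
      (InjectiveResolution.isLiftOf_ofEquivalence (toLComod k A) g hψ)) _

end Comparison

end

theorem mainTheorem2 (k A : Type u) [Field k] [Ring A] [Algebra k A] [Module.Finite k A] :
    -- injective resolutions of comodules exist, and comodule maps lift to them
    (∀ M : RComod k (Module.Dual k A), Nonempty (InjectiveResolution M)) ∧
    (∀ N : LComod k (Module.Dual k A), Nonempty (InjectiveResolution N)) ∧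
    (∀ (M M' : RComod k (Module.Dual k A)) (f : M ⟶ M')
      (I : InjectiveResolution M) (I' : InjectiveResolution M'),
      ∃ φ : I.cocomplex ⟶ I'.cocomplex, IsLiftOf φ f) ∧
    (∀ (N N' : LComod k (Module.Dual k A)) (g : N ⟶ N')
      (J : InjectiveResolution N) (J' : InjectiveResolution N'),
      ∃ ψ : J.cocomplex ⟶ J'.cocomplex, IsLiftOf ψ g) ∧
    -- the natural isomorphism
    ∀ n : ℕ, ∃ θ : ∀ (M : ModuleCat.{u} A) (N : ModuleCat.{u} Aᵐᵒᵖ)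
        (I : InjectiveResolution ((toRComod k A).obj M))
        (J : InjectiveResolution ((toLComod k A).obj N)),
        cotor I J n ≃ₗ[k] Hochschild k (outerObj k A M N) n,
      ∀ (M M' : ModuleCat.{u} A) (N N' : ModuleCat.{u} Aᵐᵒᵖ) (f : M ⟶ M') (g : N ⟶ N')
        (I : InjectiveResolution ((toRComod k A).obj M))
        (I' : InjectiveResolution ((toRComod k A).obj M'))
        (J : InjectiveResolution ((toLComod k A).obj N))
        (J' : InjectiveResolution ((toLComod k A).obj N'))
        (φ : I.cocomplex ⟶ I'.cocomplex) (ψ : J.cocomplex ⟶ J'.cocomplex),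
        IsLiftOf φ ((toRComod k A).map f) → IsLiftOf ψ ((toLComod k A).map g) →
        ∀ x : cotor I J n,
          θ M' N' I' J' ((cotorMap φ ψ n).hom x) =
            hochschildMap k (outerMap k A f g) n (θ M N I J x) := by
  -- Existence of resolutions and lifts rests on the abelian structure and the enough injectives
  -- inherited from modules.
  refine ⟨fun M => HasInjectiveResolution.out, fun N => HasInjectiveResolution.out,
    fun M M' f I I' => exists_isLiftOf f I I', fun N N' g J J' => exists_isLiftOf g J J',
    fun n => ⟨fun M N I J => cotorEquivHochschild I J n, ?_⟩⟩
  intro M M' N N' f g I I' J J' φ ψ hφ hψ x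
  exact cotorEquivHochschild_naturality f g hφ hψ n x
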